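/- Let $S\in\mathbb N$ and fix an orthonormal basis $\{\phi_k, k\in Z_0\}\cup\{\psi_{l,k}: l>0, k\in Z_l\}$ of $L_2([0,1])$ with finite $Z_l\subset\mathbb Z$, $|Z_l|\le c\,2^l$, of the form $\psi_{l,k}(x)=2^{l/2}\psi_k(2^l x)$ with measurable $\phi_k,\psi_k$, such that $\int_0^1 x^m\psi_{l,k}(x)\,dx=0$ for $0\le m<S$, such that $\big(\sum_{k\in Z_0}\phi_k^2(x)+\sum_{0<l\le J}\sum_{k\in Z_l}\psi_{l,k}^2(x)\big)^{1/2}\le c'\,2^{J/2}$ for all $x\in[0,1]$ and $J\ge 0$, and such that the interior wavelets are translates of one compactly supported mother wavelet: for some $K\in\mathbb N$ and some $\psi$ that vanishes off $[-K,K]$, $\psi_k(y)=\psi(y-k)$ for all $k\ge K$, and $k\in Z_l$ whenever $l>0$ and $K\le k<2^l-K$. (Cohen–Daubechies–Vial bases are of this type.) For $1\le p\le 2$, $r\ge 0$ and $B>0$ let $\Sigma(r,B)$ be the set of all $f\in L_p([0,1])$ with $$\|f\|_{r,p,\infty}=\max\Big(|(\langle f,\phi_k\rangle)_k|_{\ell_p},\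 \sup_{l>0}2^{l(r+1/2-1/p)}|(\langle f,\psi_{l,k}\rangle)_k|_{\ell_p}\Big)\le B ,$$ and for $\rho\ge 0$ let $\tilde\Sigma(t,B,\rho)=\{f\in\Sigma(t,B): \inf_{g\in\Sigma(s,B)}\|f-g\|_p\ge\rho\}$. For $n\ge 1$ one observes the path $Y^{(n)}(x)=\int_0^x f(u)\,du+\beta_x/\sqrt n$, $x\in[0,1]$, where $\beta$ is a standard Brownian motion and $f\in L_2([0,1])$; $\Pr_f$ is the probability under $f$. For $C\subset L_p$ let $|C|=\inf\{\tau\ge0:\exists g\in L_p,\ C\subset\{h:\|h-g\|_p\le\tau\}\}\in[0,\infty]$. Given $\alpha>0$, $t<s$ and models $\mathcal P_n\subset\Sigma(t,B)\cap L_2$, a sequence of random sets $C_n=C_n(Y^{(n)})\subset L_p$ (for which the events below are measurable) is called $(L_p,\alpha)$-honest and adaptive given $\mathcal P_n$, $\{s,t\}$ and $B$ if there is a constant $L$ such that for every $n\ge1$ $$\sup_{f\in\Sigma(r,B)\cap\mathcal P_n}\Pr_f\big(|C_n|\ge L\,n^{-r/(2r+1)}\big)\le\alpha\quad\text{for } r\in\{s,t\},\qquad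 \inf_{f\in\mathcal P_n}\Pr_f(f\in C_n)\ge1-\alpha .$$ **Proposition.** Let $1\le p\le2$, $B>0$ and $0<\alpha<1/2$. There is $\upsilon_0>0$, depending only on $p$, $B$, $\alpha$ and the wavelet basis, such that for all $0<\upsilon\le\upsilon_0$ and all $s,t$ with $S>s>2t\ge1/p$ the following holds: with $\rho_n=\upsilon\, n^{-t/(2t+1/2)}$ and $\mathcal P_n=\big(\tilde\Sigma(t,B,\rho_n)\cup\Sigma(s,B)\big)\cap L_2$, no $(L_p,\alpha)$-honest and adaptive confidence set given $\mathcal P_n$, $\{s,t\}$ and $B$ exists. -/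

import Mathlib

open MeasureTheory ProbabilityTheory
open scoped ENNReal NNReal

noncomputable section

namespace HonestSets

/-- Lebesgue measure on the unit interval. -/
abbrev unitVolume : Measure ℝ := volume.restrict (Set.Icc (0 : ℝ) 1)

/-- The space `L_p([0,1])`, for a real exponent `p`. -/
abbrev LpUnit (p : ℝ) : Type := Lp ℝ (ENNReal.ofReal p) unitVolume

/-- The pairing `⟨g, f⟩ = ∫₀¹ g(x) f(x) dx`. -/
def pairing (g f : ℝ → ℝ) : ℝ := ∫ x in Set.Icc (0 : ℝ) 1, g x * f x

/-- The dilation `x ↦ 2^{l/2} g(2^l x)`. -/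
def dilate (l : ℕ) (g : ℝ → ℝ) (x : ℝ) : ℝ := (2 : ℝ) ^ ((l : ℝ) / 2) * g (2 ^ l * x)

/-- An orthonormal wavelet basis of `L_2([0,1])` with `S` vanishing moments,
`{φ_k, k ∈ Z_0} ∪ {ψ_{l,k}, l > 0, k ∈ Z_l}` with `ψ_{l,k}(x) = 2^{l/2} ψ_k(2^l x)`.
Away from the two end points of the interval the wavelets are the translates and dilates of one
compactly supported mother wavelet; near the end points they may be corrected. The
Cohen-Daubechies-Vial bases are of this form (the boundary wavelets carry the labels that are not
used by interior ones, and `Z_l` may be empty below the coarsest level). -/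
structure WaveletBasis (S : ℕ) where
  /-- the index sets -/
  Z : ℕ → Finset ℤ
  /-- the scaling functions -/
  scal : ℤ → ℝ → ℝ
  /-- the functions `ψ_k` -/
  wav : ℤ → ℝ → ℝ
  /-- the mother wavelet -/
  mother : ℝ → ℝ
  /-- the half-width of the support of the mother wavelet and of the two boundary zones -/
  width : ℕ
  measurable_scal : ∀ k, Measurable (scal k)
  measurable_wav : ∀ k, Measurable (wav k)
  /-- the index sets have at most `c 2^l` elements -/
  card_le : ∃ c : ℝ, ∀ l, ((Z l).card : ℝ) ≤ c * 2 ^ l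
  /-- orthonormality -/
  scal_scal : ∀ k ∈ Z 0, ∀ k' ∈ Z 0, pairing (scal k) (scal k') = if k = k' then 1 else 0
  scal_wav : ∀ k ∈ Z 0, ∀ l, 0 < l → ∀ k' ∈ Z l,
    pairing (scal k) (dilate l (wav k')) = 0
  wav_wav : ∀ l, 0 < l → ∀ k ∈ Z l, ∀ l', 0 < l' → ∀ k' ∈ Z l',
    pairing (dilate l (wav k))
      (dilate l' (wav k')) =
        if l = l' ∧ k = k' then 1 else 0
  /-- completeness in `L_2([0,1])` -/
  complete : ∀ f : ℝ → ℝ, MemLp f 2 unitVolume →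
    (∀ k ∈ Z 0, pairing (scal k) f = 0) →
    (∀ l, 0 < l → ∀ k ∈ Z l,
      pairing (dilate l (wav k)) f = 0) →
    f =ᵐ[unitVolume] 0
  /-- the first `S` moments of every wavelet vanish -/
  moments : ∀ l, 0 < l → ∀ k ∈ Z l, ∀ m < S,
    pairing (dilate l (wav k)) (fun x => x ^ m) = 0
  /-- uniform bound on the square function of the basis -/
  sqrt_sum_le : ∃ c : ℝ, ∀ x ∈ Set.Icc (0 : ℝ) 1, ∀ J : ℕ,
    Real.sqrt ((∑ k ∈ Z 0, scal k x ^ 2) +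
      ∑ l ∈ Finset.Ioc 0 J, ∑ k ∈ Z l,
        dilate l (wav k) x ^ 2) ≤ c * (2 : ℝ) ^ ((J : ℝ) / 2)
  /-- the mother wavelet is compactly supported -/
  mother_support : ∀ y : ℝ, (width : ℝ) < |y| → mother y = 0
  /-- interior wavelets are translates of the mother wavelet -/
  wav_interior : ∀ k : ℤ, (width : ℤ) ≤ k → ∀ y : ℝ, wav k y = mother (y - k)
  /-- all interior wavelets belong to the basis -/
  interior_mem : ∀ l, 0 < l → ∀ k : ℤ, (width : ℤ) ≤ k → k < 2 ^ l - (width : ℤ) → k ∈ Z l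

namespace WaveletBasis

variable {S : ℕ} (W : WaveletBasis S)

/-- The wavelet `ψ_{l,k}(x) = 2^{l/2} ψ_k(2^l x)`. -/
def psi (l : ℕ) (k : ℤ) : ℝ → ℝ := dilate l (W.wav k)

/-- The sequence norm `|(⟨f, φ_k⟩)_k|_{l_p}`. -/
def scalNorm (p : ℝ) (f : ℝ → ℝ) : ℝ :=
  (∑ k ∈ W.Z 0, |pairing (W.scal k) f| ^ p) ^ (1 / p)

/-- The sequence norm `|(⟨f, ψ_{l,k}⟩)_k|_{l_p}` at level `l`. -/
def levelNorm (p : ℝ) (l : ℕ) (f : ℝ → ℝ) : ℝ :=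
  (∑ k ∈ W.Z l, |pairing (W.psi l k) f| ^ p) ^ (1 / p)

/-- The Besov norm `‖f‖_{r,p,∞}`, with values in `[0,∞]`. -/
def besovNorm (r p : ℝ) (f : ℝ → ℝ) : ℝ≥0∞ :=
  max (ENNReal.ofReal (W.scalNorm p f))
    (⨆ (l : ℕ) (_ : 0 < l),
      ENNReal.ofReal ((2 : ℝ) ^ ((l : ℝ) * (r + 1 / 2 - 1 / p)) * W.levelNorm p l f))

/-- The Besov ball `Σ(r,B) = Σ(r,p,B)` in `L_p([0,1])`. -/
def besovBall (p r B : ℝ) : Set (LpUnit p) :=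
  {f | W.besovNorm r p f ≤ ENNReal.ofReal B}

end WaveletBasis

/-- The distance `‖f - G‖_p = inf_{g ∈ G} ‖f - g‖_p`. -/
def distTo {p : ℝ} (f : LpUnit p) (G : Set (LpUnit p)) : ℝ := ⨅ g : G, ‖f - (g : LpUnit p)‖

/-- The set of functions of `Σ(t,B)` at distance at least `ρ` from `Σ(s,B)`. -/
def separatedBall {S : ℕ} (W : WaveletBasis S) (p t s B ρ : ℝ) : Set (LpUnit p) :=
  {f | f ∈ W.besovBall p t B ∧ ρ ≤ distTo f (W.besovBall p s B)}

/-- The model: the functions in `L_2` that belong to the separated ball or to `Σ(s,B)`. -/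
def model {S : ℕ} (W : WaveletBasis S) (p t s B ρ : ℝ) : Set (LpUnit p) :=
  {f | f ∈ separatedBall W p t s B ρ ∪ W.besovBall p s B ∧ MemLp f 2 unitVolume}

/-- The `L_p`-diameter `inf {τ ≥ 0 : C is contained in a closed ball of radius τ}`, with values
in `[0,∞]`. -/
def diameter {p : ℝ} (C : Set (LpUnit p)) : ℝ≥0∞ :=
  ⨅ (τ : ℝ≥0) (_ : ∃ g : LpUnit p, C ⊆ {h | ‖h - g‖ ≤ τ}), (τ : ℝ≥0∞)

/-- The observed path `x ↦ ∫₀ˣ f(u) du + β_x / √n` for `x` in `[0,1]`, that is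
`dY(x) = f(x) dx + dβ_x / √n`. -/
def observation {Ω : Type*} (β : ℝ≥0 → Ω → ℝ) (f : ℝ → ℝ) (n : ℕ) (ω : Ω) :
    Set.Icc (0 : ℝ) 1 → ℝ :=
  fun x => (∫ u in (0 : ℝ)..(x : ℝ), f u) + β (x : ℝ).toNNReal ω / Real.sqrt n

/-- `C n` maps the observed path to a subset of `L_p`. It is `(L_p, α)`-honest and adaptive given
the models `Pn n`, the set `I` of smoothness indices and the radius `B`. The events whose
probability is taken are required to be measurable for the `σ`-algebra that is generated by the
coordinates of the path. -/
def IsHonestAdaptive {S : ℕ} (W : WaveletBasis S) {Ω : Type*} [MeasurableSpace Ω]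
    (P : Measure Ω) (β : ℝ≥0 → Ω → ℝ) (p α B : ℝ) (I : Set ℝ) (Pn : ℕ → Set (LpUnit p))
    (C : ℕ → (Set.Icc (0 : ℝ) 1 → ℝ) → Set (LpUnit p)) : Prop :=
  ∃ L : ℝ, ∀ n : ℕ, 1 ≤ n →
    (∀ r ∈ I,
      MeasurableSet {y | ENNReal.ofReal (L * (n : ℝ) ^ (-(r / (2 * r + 1)))) ≤ diameter (C n y)} ∧
      ∀ f ∈ W.besovBall p r B ∩ Pn n,
        P {ω | ENNReal.ofReal (L * (n : ℝ) ^ (-(r / (2 * r + 1)))) ≤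
          diameter (C n (observation β f n ω))} ≤ ENNReal.ofReal α) ∧
    (∀ f ∈ Pn n,
      MeasurableSet {y | f ∈ C n y} ∧
      ENNReal.ofReal (1 - α) ≤ P {ω | f ∈ C n (observation β f n ω)})

end HonestSets

end

/-!
A confidence set that adapts to `Σ(s, B)` must be small when the signal is zero. The proof exhibits
`m` groups of rough signals such that signals of different groups are too far apart to lie in one
small set, while a uniformly chosen signal of any one group cannot be told apart from the zero
signal. Coverage on the `i`-th group then forces the confidence set to meet that group with
probability at least `1 - α - δ` under the zero signal, and to meet it while being small with
probability at least `1 - 2 α - δ`. A small set meets at most one group, so these `m` events are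
disjoint and `m (1 - 2 α - δ) ≤ 1` (`mul_le_one_of_separated`). For `α < 1 / 2` this fails if `δ` is
small and `m` is large. Using many groups instead of the zero function and a single group is what
allows all levels `α < 1 / 2` rather than `α < 1 / 3`.

The signals of a group are `∑ k, ± a ψ_{j,k}` (`WaveletBasis.bump`), where `k` runs through
`N ≈ 2^j` interior wavelets with disjoint supports, `a ≈ 2^{-j(t + 1/2)}` and
`n ≈ 2^{j(2t + 1/2)}`. Such a sum lies in `Σ(t, B)` (`besovNorm_bump_le`). Testing against the sum
itself, which up to the factor `a` is bounded by a multiple of `2^{j/2}` since the supports are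
disjoint, shows that it is at `L_p`-distance of order `2^{-jt}`, hence of order
`n^{-t/(2t + 1/2)}`, from `Σ(s, B)` and from the other groups (`le_norm_bump_sub`,
`le_norm_bump_sub_bump`). The inequality `s > 2t` says precisely that this distance is of larger
order than `n^{-s/(2s + 1)}`.

Indistinguishability (`sum_measureReal_observation_le`) is a chi-square bound for the mixture over
the signs. On finitely many coordinates of the path a shift by `f` acts through the projection of
`f` to the span of finitely many indicators `1_{[0, x]}`, and the Cameron–Martin formula
(`IsGaussianGram.map_withDensity_likelihood`) gives the likelihood ratio. The chi-square divergence
is an exponential moment of a decoupled chaos in the signs. It is bounded by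
`exp (n² a⁴ N / 2) - 1` for every projection (`sum_exp_inner_starProjection_le`), that is uniformly
in the coordinates, so the bound passes from cylinder sets to all measurable sets of paths and no
stochastic integral is needed.
-/

namespace HonestSets

open scoped RealInnerProductSpace

/-! ### The Cameron–Martin formula for finite Gaussian families -/

/-- A finite centred Gaussian family `Z` whose covariances are the inner products of the vectors
`e i`. In the application `e i` is a multiple of the indicator of an interval
`[0, x_i]`. -/
structure IsGaussianGram {ι Ω H : Type*} [Fintype ι] [MeasurableSpace Ω] [NormedAddCommGroup H]
    [InnerProductSpace ℝ H] (Z : ι → Ω → ℝ) (e : ι → H) (P : Measure Ω) : Prop where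
  measurable : ∀ i, Measurable (Z i)
  hasGaussianLaw : HasGaussianLaw (fun ω i ↦ Z i ω) P
  mean : ∀ i, ∫ ω, Z i ω ∂P = 0
  cov : ∀ i j, cov[Z i, Z j; P] = ⟪e i, e j⟫

/-- The Cameron–Martin likelihood ratio of the shift by the vector `∑ i, c i • e i`. -/
noncomputable def likelihood {ι Ω H : Type*} [Fintype ι] [NormedAddCommGroup H]
    [InnerProductSpace ℝ H] (Z : ι → Ω → ℝ) (e : ι → H) (c : ι → ℝ) (ω : Ω) : ℝ :=
  Real.exp (∑ i, c i * Z i ω - ‖∑ i, c i • e i‖ ^ 2 / 2)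

section CameronMartin

variable {ι Ω H : Type*} [Fintype ι] [NormedAddCommGroup H] [InnerProductSpace ℝ H]
  {Z : ι → Ω → ℝ} {e : ι → H}

lemma likelihood_eq (c : ι → ℝ) (ω : Ω) : likelihood Z e c ω =
    Real.exp (-(‖∑ i, c i • e i‖ ^ 2 / 2)) * Real.exp (∑ i, c i * Z i ω) := by
  rw [likelihood, ← Real.exp_add]; ring_nf

lemma likelihood_mul (c d : ι → ℝ) (ω : Ω) : likelihood Z e c ω * likelihood Z e d ω =
    Real.exp (-(‖∑ i, c i • e i‖ ^ 2 / 2 + ‖∑ i, d i • e i‖ ^ 2 / 2)) *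
      Real.exp (∑ i, (c i + d i) * Z i ω) := by
  rw [likelihood, likelihood, ← Real.exp_add, ← Real.exp_add]
  simp only [add_mul, Finset.sum_add_distrib]; ring_nf

namespace IsGaussianGram

variable [MeasurableSpace Ω] {P : Measure Ω}

lemma map_sum (h : IsGaussianGram Z e P) (c : ι → ℝ) :
    P.map (fun ω ↦ ∑ i, c i * Z i ω) = gaussianReal 0 (‖∑ i, c i • e i‖₊ ^ 2) := by
  have : IsProbabilityMeasure P := h.hasGaussianLaw.isProbabilityMeasure
  have hL : HasGaussianLaw (fun ω ↦ ∑ i, c i * Z i ω) P := by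
    have := h.hasGaussianLaw.map_fun
      (∑ i, c i • ContinuousLinearMap.proj (R := ℝ) (φ := fun _ : ι ↦ ℝ) i)
    simpa using this
  have hZ (i) : MemLp (Z i) 2 P := (h.hasGaussianLaw.eval i).memLp_two
  have hcZ (i) : MemLp (fun ω ↦ c i * Z i ω) 2 P := (hZ i).const_mul _
  rw [hL.map_eq_gaussianReal]
  congr 1
  · rw [integral_finsetSum _ fun i _ ↦ (hcZ i).integrable (by norm_num)]
    simp [integral_const_mul, h.mean]
  · rw [variance_fun_sum hcZ, ← NNReal.coe_inj, Real.coe_toNNReal]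
    · push_cast
      rw [← real_inner_self_eq_norm_sq, sum_inner]
      refine Finset.sum_congr rfl fun i _ ↦ ?_
      rw [inner_sum]
      refine Finset.sum_congr rfl fun j _ ↦ ?_
      rw [covariance_const_mul_left, covariance_const_mul_right, inner_smul_left, inner_smul_right,
        h.cov]
      simp
    · rw [← variance_fun_sum hcZ]
      exact variance_nonneg _ _

lemma integral_exp_sum (h : IsGaussianGram Z e P) (c : ι → ℝ) :
    ∫ ω, Real.exp (∑ i, c i * Z i ω) ∂P = Real.exp (‖∑ i, c i • e i‖ ^ 2 / 2) := by
  have := mgf_gaussianReal (h.map_sum c) 1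
  simpa [mgf] using this

lemma integrable_exp_sum (h : IsGaussianGram Z e P) (c : ι → ℝ) :
    Integrable (fun ω ↦ Real.exp (∑ i, c i * Z i ω)) P := by
  -- Otherwise the integral would be `0` by convention.
  by_contra hn
  have := h.integral_exp_sum c
  rw [integral_undef hn] at this
  exact (Real.exp_pos _).ne this

lemma measurable_likelihood (h : IsGaussianGram Z e P) (c : ι → ℝ) :
    Measurable (likelihood Z e c) := by
  have := h.measurable
  unfold likelihood
  fun_prop

lemma integrable_likelihood (h : IsGaussianGram Z e P) (c : ι → ℝ) :
    Integrable (likelihood Z e c) P := by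
  simp_rw [funext (likelihood_eq (Z := Z) (e := e) c)]
  exact (h.integrable_exp_sum c).const_mul _

lemma integral_likelihood (h : IsGaussianGram Z e P) (c : ι → ℝ) :
    ∫ ω, likelihood Z e c ω ∂P = 1 := by
  simp_rw [likelihood_eq, integral_const_mul, h.integral_exp_sum, ← Real.exp_add]
  simp

lemma integrable_likelihood_mul (h : IsGaussianGram Z e P) (c d : ι → ℝ) :
    Integrable (fun ω ↦ likelihood Z e c ω * likelihood Z e d ω) P := by
  simp_rw [likelihood_mul]
  exact (h.integrable_exp_sum _).const_mul _

lemma integral_likelihood_mul (h : IsGaussianGram Z e P) (c d : ι → ℝ) :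
    ∫ ω, likelihood Z e c ω * likelihood Z e d ω ∂P =
      Real.exp ⟪∑ i, c i • e i, ∑ i, d i • e i⟫ := by
  simp_rw [likelihood_mul, integral_const_mul, h.integral_exp_sum, ← Real.exp_add, add_smul,
    Finset.sum_add_distrib, norm_add_sq_real]
  ring_nf

/-- The Cameron–Martin formula. The one-dimensional marginals of the two sides have the same
moment generating function, hence the same characteristic function. -/
lemma map_withDensity_likelihood (h : IsGaussianGram Z e P) (c : ι → ℝ) :
    (P.withDensity fun ω ↦ ENNReal.ofReal (likelihood Z e c ω)).map (fun ω i ↦ Z i ω) =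
      P.map (fun ω i ↦ ⟪e i, ∑ j, c j • e j⟫ + Z i ω) := by
  have hP : IsProbabilityMeasure P := h.hasGaussianLaw.isProbabilityMeasure
  have hZm := h.measurable
  have hlm := h.measurable_likelihood c
  set v := ∑ j, c j • e j with hv
  set Q := P.withDensity fun ω ↦ ENNReal.ofReal (likelihood Z e c ω) with hQ
  have hl0 : ∀ ω, 0 ≤ likelihood Z e c ω := fun ω ↦ (Real.exp_pos _).le
  have hQp : IsProbabilityMeasure Q := by
    refine ⟨?_⟩
    rw [hQ, withDensity_apply _ MeasurableSet.univ, setLIntegral_univ,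
      ← ofReal_integral_eq_lintegral_ofReal (h.integrable_likelihood c) (ae_of_all _ hl0),
      h.integral_likelihood]
    simp
  have m1 : Measurable (fun ω i ↦ Z i ω) := by fun_prop
  have m2 : Measurable (fun ω i ↦ ⟪e i, v⟫ + Z i ω) := by fun_prop
  have := Measure.isProbabilityMeasure_map (μ := Q) m1.aemeasurable
  have := Measure.isProbabilityMeasure_map (μ := P) m2.aemeasurable
  refine Measure.ext_of_charFunDual (funext fun L ↦ ?_)
  classical
  set l : ι → ℝ := fun i ↦ L (Pi.single i 1) with hl
  have hLx (x : ι → ℝ) : L x = ∑ i, l i * x i := by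
    conv_lhs => rw [pi_eq_sum_univ' x]
    rw [_root_.map_sum]
    refine Finset.sum_congr rfl fun i _ ↦ ?_
    rw [map_smul, smul_eq_mul, mul_comm, hl]
  set w := ∑ i, l i • e i with hw
  have hwv : ∑ i, l i * ⟪e i, v⟫ = ⟪w, v⟫ := by
    rw [hw, sum_inner]
    exact Finset.sum_congr rfl fun i _ ↦ by rw [inner_smul_left]; simp
  have hexp (t : ℝ) (ω : Ω) : Real.exp (t * L (fun i ↦ ⟪e i, v⟫ + Z i ω)) =
      Real.exp (t * ⟪w, v⟫) * Real.exp (∑ i, (t * l i) * Z i ω) := by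
    rw [hLx, ← Real.exp_add]
    simp only [mul_add, Finset.sum_add_distrib, hwv, Finset.mul_sum, mul_assoc]
  have htw (t : ℝ) : ∑ i, (t * l i) • e i = t • w := by
    simp [hw, Finset.smul_sum, mul_smul]
  have hmgf : mgf (fun ω ↦ L (fun i ↦ ⟪e i, v⟫ + Z i ω)) P =
      mgf (fun ω ↦ L (fun i ↦ Z i ω)) Q := by
    funext t
    simp only [mgf]
    simp_rw [hexp, integral_const_mul, h.integral_exp_sum, htw]
    rw [hQ, integral_withDensity_eq_integral_toReal_smul (by fun_prop)
      (ae_of_all _ fun _ ↦ ENNReal.ofReal_lt_top)]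
    have (ω : Ω) : (ENNReal.ofReal (likelihood Z e c ω)).toReal •
        Real.exp (t * L fun i ↦ Z i ω) =
        Real.exp (-(‖v‖ ^ 2 / 2)) * Real.exp (∑ i, (c i + t * l i) * Z i ω) := by
      rw [ENNReal.toReal_ofReal (hl0 ω), likelihood_eq, hLx, smul_eq_mul, mul_assoc,
        ← Real.exp_add, Finset.mul_sum, ← Finset.sum_add_distrib]
      congr 2
      exact Finset.sum_congr rfl fun i _ ↦ by ring
    simp_rw [this, integral_const_mul, h.integral_exp_sum, add_smul, Finset.sum_add_distrib, htw,
      ← hv, norm_add_sq_real, ← Real.exp_add, inner_smul_right, real_inner_comm]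
    ring_nf
  have hint : integrableExpSet (fun ω ↦ L (fun i ↦ ⟪e i, v⟫ + Z i ω)) P = Set.univ := by
    refine Set.eq_univ_of_forall fun t ↦ ?_
    simp only [integrableExpSet, Set.mem_ofPred_eq]
    simp_rw [hexp]
    exact (h.integrable_exp_sum _).const_mul _
  have key := eqOn_complexMGF_of_mgf hmgf (x := Complex.I) (by simp [hint])
  simp only [complexMGF] at key
  rw [charFunDual_apply, charFunDual_apply, integral_map m1.aemeasurable (by fun_prop),
    integral_map m2.aemeasurable (by fun_prop)]
  simp_rw [mul_comm Complex.I] at key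
  exact key.symm

end IsGaussianGram

end CameronMartin

/-! ### Mixtures of Gaussian shifts over random signs -/

namespace IsGaussianGram

variable {ι Ω H : Type*} [Fintype ι] [NormedAddCommGroup H] [InnerProductSpace ℝ H]
  {Z : ι → Ω → ℝ} {e : ι → H} [MeasurableSpace Ω] {P : Measure Ω}

lemma measureReal_shift (h : IsGaussianGram Z e P) (c : ι → ℝ) {A : Set (ι → ℝ)}
    (hA : MeasurableSet A) :
    P.real {ω | (fun i ↦ ⟪e i, ∑ j, c j • e j⟫ + Z i ω) ∈ A} =
      ∫ ω in {ω | (fun i ↦ Z i ω) ∈ A}, likelihood Z e c ω ∂P := by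
  have hZm := h.measurable
  have m1 : Measurable (fun ω i ↦ Z i ω) := by fun_prop
  have m2 : Measurable (fun ω i ↦ ⟪e i, ∑ j, c j • e j⟫ + Z i ω) := by fun_prop
  have key := DFunLike.congr_fun (h.map_withDensity_likelihood c) A
  rw [Measure.map_apply m1 hA, Measure.map_apply m2 hA, withDensity_apply _ (m1 hA)] at key
  rw [integral_eq_lintegral_of_nonneg_ae (ae_of_all _ fun ω ↦
    (by exact (Real.exp_pos _).le : 0 ≤ likelihood Z e c ω))
    (h.measurable_likelihood c).aestronglyMeasurable, Measure.real]
  exact congrArg ENNReal.toReal key.symm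

/-- The second moment bound for a mixture of shifts: if the chi-square divergence of the mixture
is at most `δ ^ 2`, then its probabilities exceed those of the centred law by at most `δ`. -/
lemma sum_measureReal_shift_le (h : IsGaussianGram Z e P) {J : Type*} [Fintype J] [Nonempty J]
    (c : J → ι → ℝ) {δ : ℝ} (hδ : 0 < δ)
    (hc : ∑ b, ∑ b', Real.exp ⟪∑ i, c b i • e i, ∑ i, c b' i • e i⟫ ≤
      (Fintype.card J : ℝ) ^ 2 * (1 + δ ^ 2)) {A : Set (ι → ℝ)} (hA : MeasurableSet A) :
    ∑ b, P.real {ω | (fun i ↦ ⟪e i, ∑ j, c b j • e j⟫ + Z i ω) ∈ A} ≤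
      Fintype.card J * (P.real {ω | (fun i ↦ Z i ω) ∈ A} + δ) := by
  have hP : IsProbabilityMeasure P := h.hasGaussianLaw.isProbabilityMeasure
  set M : ℝ := (Fintype.card J : ℝ) with hM
  have hM0 : 0 < M := by rw [hM]; exact_mod_cast Fintype.card_pos
  set S := {ω | (fun i ↦ Z i ω) ∈ A} with hS
  set l : Ω → ℝ := fun ω ↦ (∑ b, likelihood Z e (c b) ω) / M with hl
  have hli : Integrable l P := (integrable_finsetSum _ fun b _ ↦
    h.integrable_likelihood (c b)).div_const _
  have hl1 : ∫ ω, l ω ∂P = 1 := by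
    simp_rw [hl, integral_div, integral_finsetSum _ fun b _ ↦ h.integrable_likelihood (c b),
      h.integral_likelihood]
    simp [← hM, hM0.ne']
  have hsq (ω : Ω) : l ω ^ 2 =
      (∑ b, ∑ b', likelihood Z e (c b) ω * likelihood Z e (c b') ω) / M ^ 2 := by
    simp only [hl]
    rw [div_pow, sq (∑ b, _), Finset.sum_mul_sum]
  have hsqi : Integrable (fun ω ↦ l ω ^ 2) P := by
    simp_rw [hsq]
    exact (integrable_finsetSum _ fun b _ ↦ integrable_finsetSum _ fun b' _ ↦
      h.integrable_likelihood_mul _ _).div_const _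
  have hl2 : ∫ ω, l ω ^ 2 ∂P ≤ 1 + δ ^ 2 := by
    simp_rw [hsq, integral_div]
    rw [integral_finsetSum _ fun b _ ↦ integrable_finsetSum _ fun b' _ ↦
      h.integrable_likelihood_mul _ _, div_le_iff₀ (by positivity), mul_comm]
    refine le_trans (le_of_eq ?_) hc
    refine Finset.sum_congr rfl fun b _ ↦ ?_
    rw [integral_finsetSum _ fun b' _ ↦ h.integrable_likelihood_mul _ _]
    exact Finset.sum_congr rfl fun b' _ ↦ h.integral_likelihood_mul _ _
  have hdi : Integrable (fun ω ↦ (l ω - 1) ^ 2) P := by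
    have : (fun ω ↦ (l ω - 1) ^ 2) = fun ω ↦ l ω ^ 2 - 2 * l ω + 1 := by funext ω; ring
    rw [this]
    exact (hsqi.sub (hli.const_mul 2)).add (integrable_const 1)
  have hd : ∫ ω, (l ω - 1) ^ 2 ∂P ≤ δ ^ 2 := by
    have : (fun ω ↦ (l ω - 1) ^ 2) = fun ω ↦ (l ω ^ 2 - 2 * l ω) + 1 := by funext ω; ring
    have hi : Integrable (fun ω ↦ l ω ^ 2 - 2 * l ω) P := hsqi.sub (hli.const_mul 2)
    rw [this, integral_add hi (integrable_const 1),
      integral_sub hsqi (hli.const_mul 2), integral_const_mul, hl1]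
    simp; linarith
  have hsum : ∑ b, P.real {ω | (fun i ↦ ⟪e i, ∑ j, c b j • e j⟫ + Z i ω) ∈ A} =
      M * ∫ ω in S, l ω ∂P := by
    simp_rw [h.measureReal_shift _ hA, hl, integral_div]
    rw [integral_finsetSum _ fun b _ ↦ (h.integrable_likelihood (c b)).integrableOn]
    exact (mul_div_cancel₀ _ hM0.ne').symm
  rw [hsum]
  refine mul_le_mul_of_nonneg_left ?_ hM0.le
  have h1 : ∫ ω in S, l ω ∂P = P.real S + ∫ ω in S, (l ω - 1) ∂P := by
    rw [integral_sub hli.integrableOn (integrable_const 1).integrableOn]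
    simp
  -- `x ≤ (x ^ 2 / δ + δ) / 2` replaces the Cauchy–Schwarz inequality.
  have h2 : ∫ ω in S, (l ω - 1) ∂P ≤ ∫ ω in S, ((l ω - 1) ^ 2 / δ + δ) / 2 ∂P := by
    refine integral_mono (hli.sub (integrable_const 1)).integrableOn
      (((hdi.div_const δ).add (integrable_const δ)).div_const 2).integrableOn fun ω ↦ ?_
    rw [le_div_iff₀ two_pos, ← sub_nonneg]
    have : (l ω - 1) ^ 2 / δ + δ - (l ω - 1) * 2 = (l ω - 1 - δ) ^ 2 / δ := by
      field_simp; ring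
    rw [this]; positivity
  have h3 : ∫ ω in S, ((l ω - 1) ^ 2 / δ + δ) / 2 ∂P ≤
      ∫ ω, ((l ω - 1) ^ 2 / δ + δ) / 2 ∂P :=
    setIntegral_le_integral (((hdi.div_const δ).add (integrable_const δ)).div_const 2)
      (ae_of_all _ fun ω ↦ by simp only [Pi.zero_apply]; positivity)
  have h4 : ∫ ω, ((l ω - 1) ^ 2 / δ + δ) / 2 ∂P ≤ δ := by
    rw [integral_div, integral_add (hdi.div_const δ) (integrable_const δ), integral_div]
    have : (∫ ω, (l ω - 1) ^ 2 ∂P) / δ ≤ δ := by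
      rw [div_le_iff₀ hδ]; nlinarith
    simp; linarith
  linarith

end IsGaussianGram

/-- The sign `±1` encoded by a Boolean. -/
def sgn (b : Bool) : ℝ := if b then 1 else -1

lemma sgn_mul_self (b : Bool) : sgn b * sgn b = 1 := by cases b <;> simp [sgn]

lemma abs_sgn (b : Bool) : |sgn b| = 1 := by cases b <;> simp [sgn]

lemma sum_exp_sum_sgn_le {N : ℕ} (x : Fin N → ℝ) :
    ∑ b : Fin N → Bool, Real.exp (∑ k, sgn (b k) * x k) ≤
      2 ^ N * Real.exp ((∑ k, x k ^ 2) / 2) := by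
  have h1 : ∑ b : Fin N → Bool, Real.exp (∑ k, sgn (b k) * x k) =
      ∏ k, ∑ s : Bool, Real.exp (sgn s * x k) := by
    simp_rw [Finset.prod_univ_sum, Fintype.piFinset_univ, Real.exp_sum]
  have h2 (k : Fin N) : ∑ s : Bool, Real.exp (sgn s * x k) = 2 * Real.cosh (x k) := by
    simp [sgn, Real.cosh_eq]
    ring
  simp_rw [h1, h2, Finset.prod_mul_distrib, Finset.sum_div, Real.exp_sum]
  simp only [Finset.prod_const, Finset.card_univ, Fintype.card_fin]
  gcongr with k
  exact Real.cosh_le_exp_half_sq _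

/-- A decoupled exponential moment bound for random signs. Projecting the orthonormal vectors to a
subspace destroys their orthogonality, but not the bound, by Bessel's inequality. -/
lemma sum_exp_inner_starProjection_le {H : Type*} [NormedAddCommGroup H] [InnerProductSpace ℝ H]
    (V : Submodule ℝ H) [V.HasOrthogonalProjection] {N : ℕ} {ψ : Fin N → H}
    (hψ : Orthonormal ℝ ψ) (a : ℝ) :
    ∑ b : Fin N → Bool, ∑ b' : Fin N → Bool,
      Real.exp ⟪V.starProjection (∑ k, (a * sgn (b k)) • ψ k),
        V.starProjection (∑ k, (a * sgn (b' k)) • ψ k)⟫ ≤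
      ((2 : ℝ) ^ N) ^ 2 * Real.exp (a ^ 4 * N / 2) := by
  have hn (b : Fin N → Bool) : ‖∑ k, (a * sgn (b k)) • ψ k‖ ^ 2 = a ^ 2 * N := by
    rw [← real_inner_self_eq_norm_sq, hψ.inner_sum]
    have (k : Fin N) : a * sgn (b k) * (a * sgn (b k)) = a ^ 2 := by
      linear_combination a ^ 2 * sgn_mul_self (b k)
    simp [this, mul_comm]
  have hin (b : Fin N → Bool) : ∑ b' : Fin N → Bool,
      Real.exp ⟪V.starProjection (∑ k, (a * sgn (b k)) • ψ k),
        V.starProjection (∑ k, (a * sgn (b' k)) • ψ k)⟫ ≤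
      2 ^ N * Real.exp (a ^ 4 * N / 2) := by
    set g := V.starProjection (∑ k, (a * sgn (b k)) • ψ k) with hg
    have h1 (b' : Fin N → Bool) : ⟪g, V.starProjection (∑ k, (a * sgn (b' k)) • ψ k)⟫ =
        ∑ k, sgn (b' k) * (a * ⟪ψ k, g⟫) := by
      rw [← Submodule.inner_starProjection_left_eq_right, inner_sum]
      have : V.starProjection g = g := by
        rw [Submodule.starProjection_eq_self_iff]; exact Submodule.starProjection_apply_mem _ _
      rw [this]
      refine Finset.sum_congr rfl fun k _ ↦ ?_
      rw [inner_smul_right, real_inner_comm]; ring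
    simp_rw [h1]
    refine (sum_exp_sum_sgn_le _).trans ?_
    gcongr
    have hB : ∑ k, ⟪ψ k, g⟫ ^ 2 ≤ ‖g‖ ^ 2 := by
      have := hψ.sum_inner_products_le g (s := Finset.univ)
      simpa using this
    have hgn : ‖g‖ ^ 2 ≤ a ^ 2 * N := by
      rw [← hn b]
      gcongr
      exact V.norm_starProjection_apply_le _
    simp_rw [mul_pow, ← Finset.mul_sum]
    nlinarith [sq_nonneg a]
  calc _ ≤ ∑ _b : Fin N → Bool, 2 ^ N * Real.exp (a ^ 4 * N / 2) := by
        gcongr with b; exact hin b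
    _ = _ := by simp; ring

/-- A mixture over random signs of Gaussian shifts in orthonormal directions is close to the
centred law, uniformly in the finite set of coordinates that are observed. -/
lemma IsGaussianGram.sum_measureReal_sgn_le {ι Ω H : Type*} [Fintype ι] [NormedAddCommGroup H]
    [InnerProductSpace ℝ H] {Z : ι → Ω → ℝ} {e : ι → H} [MeasurableSpace Ω] {P : Measure Ω}
    (h : IsGaussianGram Z e P) {N : ℕ} {ψ : Fin N → H} (hψ : Orthonormal ℝ ψ) {a δ : ℝ}
    (hδ : 0 < δ) (ha : Real.exp (a ^ 4 * N / 2) ≤ 1 + δ ^ 2) {A : Set (ι → ℝ)}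
    (hA : MeasurableSet A) :
    ∑ b : Fin N → Bool, P.real {ω | (fun i ↦ ⟪e i, ∑ k, (a * sgn (b k)) • ψ k⟫ + Z i ω) ∈ A} ≤
      2 ^ N * (P.real {ω | (fun i ↦ Z i ω) ∈ A} + δ) := by
  set V := Submodule.span ℝ (Set.range e) with hV
  have : FiniteDimensional ℝ V := FiniteDimensional.span_of_finite ℝ (Set.finite_range e)
  -- The shift only depends on the projection to the span of the `e i`.
  have hex (b : Fin N → Bool) : ∃ c : ι → ℝ,
      ∑ i, c i • e i = V.starProjection (∑ k, (a * sgn (b k)) • ψ k) := by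
    have := V.starProjection_apply_mem (∑ k, (a * sgn (b k)) • ψ k)
    exact (Submodule.mem_span_range_iff_exists_fun ℝ).1 this
  choose c hc using hex
  have hin (b : Fin N → Bool) (i : ι) : ⟪e i, ∑ j, c b j • e j⟫ =
      ⟪e i, ∑ k, (a * sgn (b k)) • ψ k⟫ := by
    rw [hc, ← Submodule.inner_starProjection_left_eq_right,
      V.starProjection_eq_self_iff.2 (Submodule.subset_span ⟨i, rfl⟩)]
  have key := h.sum_measureReal_shift_le c hδ (A := A) ?_ hA
  · simp_rw [hin] at key
    simpa using key
  · simp_rw [hc]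
    refine (sum_exp_inner_starProjection_le V hψ a).trans ?_
    simp only [Fintype.card_pi, Fintype.card_bool, Finset.prod_const, Finset.card_univ,
      Fintype.card_fin, Nat.cast_pow, Nat.cast_ofNat]
    gcongr

/-- An inequality between probabilities of cylinder sets extends to all measurable sets of
paths. -/
lemma sum_measureReal_le_of_cylinders {T J : Type*} [Fintype J] (Q : J → Measure (T → ℝ))
    (Q₀ : Measure (T → ℝ)) [∀ b, IsFiniteMeasure (Q b)] [IsFiniteMeasure Q₀] {M δ : ℝ}
    (h : ∀ (I : Finset T) (A : Set (I → ℝ)), MeasurableSet A →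
      ∑ b, (Q b).real (cylinder I A) ≤ M * (Q₀.real (cylinder I A) + δ))
    {A : Set (T → ℝ)} (hA : MeasurableSet A) :
    ∑ b, (Q b).real A ≤ M * (Q₀.real A + δ) := by
  refine le_of_forall_pos_le_add fun η hη ↦ ?_
  set ε : ℝ := η / (Fintype.card J + |M|  + 1) with hε
  have hε0 : 0 < ε := by positivity
  obtain ⟨t, ht, htA⟩ := exists_measure_symmDiff_lt_of_generateFrom_isSetRing
    (μ := Q₀ + ∑ b, Q b) isSetRing_measurableCylinders
    ⟨{Set.univ}, Set.countable_singleton _,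
      Set.singleton_subset_iff.2 (univ_mem_measurableCylinders _), by simp⟩
    generateFrom_measurableCylinders.symm hA (ENNReal.ofReal_pos.2 hε0)
  have htm : MeasurableSet t := .of_mem_measurableCylinders ht
  obtain ⟨I, S, hS, rfl⟩ := (mem_measurableCylinders t).1 ht
  have hle (ν : Measure (T → ℝ)) [IsFiniteMeasure ν] (hν : ν ≤ Q₀ + ∑ b, Q b) :
      |ν.real (cylinder I S) - ν.real A| ≤ ε := by
    refine (abs_measureReal_sub_le_measureReal_symmDiff
      htm.nullMeasurableSet hA.nullMeasurableSet).trans ?_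
    rw [Measure.real]
    exact ENNReal.toReal_le_of_le_ofReal hε0.le ((hν _).trans htA.le)
  have h0 := abs_le.1 (hle Q₀ (Measure.le_add_right le_rfl))
  have hb (b : J) : (Q b).real A ≤ (Q b).real (cylinder I S) + ε := by
    have hQ : Q b ≤ ∑ b, Q b := Measure.le_iff'.2 fun s ↦ by
      rw [Measure.finsetSum_apply]
      exact Finset.single_le_sum (f := fun b ↦ Q b s) (fun _ _ ↦ zero_le) (Finset.mem_univ b)
    have := abs_le.1 (hle (Q b) (Measure.le_add_left hQ))
    linarith
  have h1 : ∑ b, (Q b).real A ≤ ∑ b, (Q b).real (cylinder I S) + Fintype.card J * ε := by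
    refine (Finset.sum_le_sum fun b _ ↦ hb b).trans ?_
    simp [Finset.sum_add_distrib]
  have h2 : M * Q₀.real (cylinder I S) ≤ M * Q₀.real A + |M| * ε := by
    have : M * (Q₀.real (cylinder I S) - Q₀.real A) ≤ |M| * ε := by
      refine (le_abs_self _).trans ?_
      rw [abs_mul]
      gcongr
      exact abs_le.2 h0
    linarith
  have h3 : (Fintype.card J + |M|) * ε ≤ η := by
    rw [hε, mul_div_assoc', div_le_iff₀ (by positivity)]
    nlinarith [abs_nonneg M]
  have := h I S hS
  linarith

/-! ### The white noise model -/

instance isProbabilityMeasure_unitVolume : IsProbabilityMeasure unitVolume :=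
  ⟨by simp⟩

lemma measurable_observation {Ω : Type*} [MeasurableSpace Ω] {β : ℝ≥0 → Ω → ℝ}
    (hβ : ∀ x, Measurable (β x)) (f : ℝ → ℝ) (n : ℕ) : Measurable (observation β f n) := by
  refine measurable_pi_lambda _ fun x ↦ ?_
  unfold observation
  exact measurable_const.add ((hβ _).div_const _)

/-- The indicator of `[0, x]`, normalised so that its inner products are the covariances of
`β_x / √n`. -/
noncomputable def intervalVec (n : ℕ) (x : Set.Icc (0 : ℝ) 1) : Lp ℝ 2 unitVolume :=
  (Real.sqrt n)⁻¹ • indicatorConstLp 2 (measurableSet_Icc (a := (0 : ℝ)) (b := x))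
    (measure_ne_top _ _) (1 : ℝ)

lemma inner_intervalVec (n : ℕ) (x : Set.Icc (0 : ℝ) 1) (f : Lp ℝ 2 unitVolume) :
    ⟪intervalVec n x, f⟫ = (Real.sqrt n)⁻¹ * ∫ u in (0 : ℝ)..x, f u := by
  rw [intervalVec, inner_smul_left, L2.inner_indicatorConstLp_one,
    Measure.restrict_restrict measurableSet_Icc, Set.inter_eq_left.2
    (Set.Icc_subset_Icc_right x.2.2), integral_Icc_eq_integral_Ioc,
    intervalIntegral.integral_of_le x.2.1]
  simp

lemma inner_intervalVec_intervalVec (n : ℕ) (x y : Set.Icc (0 : ℝ) 1) :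
    ⟪intervalVec n x, intervalVec n y⟫ = (Real.sqrt n)⁻¹ * ((Real.sqrt n)⁻¹ * min x.1 y.1) := by
  rw [intervalVec, intervalVec, inner_smul_left, inner_smul_right,
    L2.real_inner_indicatorConstLp_one_indicatorConstLp_one]
  have h : volume.real (Set.Icc (0 : ℝ) (min x.1 y.1)) = min x.1 y.1 := by
    rw [Real.volume_real_Icc_of_le (le_min x.2.1 y.2.1), sub_zero]
  rw [Measure.real, Measure.restrict_apply (measurableSet_Icc.inter measurableSet_Icc),
    Set.Icc_inter_Icc, Set.Icc_inter_Icc, sup_idem, sup_idem,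
    min_eq_left (b := (1 : ℝ)) ((min_le_left _ _).trans x.2.2)]
  rw [Measure.real] at h
  rw [h]
  simp

lemma isGaussianGram_brownian {Ω : Type*} [MeasurableSpace Ω] {P : Measure Ω}
    {β : ℝ≥0 → Ω → ℝ} (hβ : ∀ x, Measurable (β x)) (hB : IsPreBrownianReal β P) (n : ℕ)
    (I : Finset (Set.Icc (0 : ℝ) 1)) :
    IsGaussianGram (fun (i : I) ω ↦ (Real.sqrt n)⁻¹ * β (i.1 : ℝ).toNNReal ω)
      (fun i ↦ intervalVec n i.1) P where
  measurable i := (hβ _).const_mul _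
  hasGaussianLaw := by
    classical
    let J : Finset ℝ≥0 := I.image fun x : Set.Icc (0 : ℝ) 1 ↦ (x : ℝ).toNNReal
    have hJ (i : I) : (i.1 : ℝ).toNNReal ∈ J := Finset.mem_image_of_mem _ i.2
    have := (hB.isGaussianProcess.hasGaussianLaw J).map_fun
      (ContinuousLinearMap.pi fun i : I ↦ (Real.sqrt n)⁻¹ •
        ContinuousLinearMap.proj (R := ℝ) (φ := fun _ : J ↦ ℝ) ⟨_, hJ i⟩)
    exact this
  mean i := by
    rw [integral_const_mul, hB.integral_eval, mul_zero]
  cov i j := by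
    rw [covariance_const_mul_left, covariance_const_mul_right, inner_intervalVec_intervalVec]
    have := hB.covariance_fun_eval (i.1 : ℝ).toNNReal (j.1 : ℝ).toNNReal
    rw [this]
    simp [Real.coe_toNNReal _ i.1.2.1, Real.coe_toNNReal _ j.1.2.1]

lemma pairing_eq_inner_toLp {f g : ℝ → ℝ} (hf : MemLp f 2 unitVolume) (hg : MemLp g 2 unitVolume) :
    ⟪hf.toLp f, hg.toLp g⟫ = pairing f g := by
  rw [L2.inner_def, pairing]
  refine integral_congr_ae ?_
  filter_upwards [hf.coeFn_toLp, hg.coeFn_toLp] with x h1 h2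
  rw [h1, h2]
  simp [mul_comm]

lemma intervalIntegral_congr_unitVolume {f g : ℝ → ℝ} (h : f =ᵐ[unitVolume] g)
    (x : Set.Icc (0 : ℝ) 1) : ∫ u in (0 : ℝ)..x, f u = ∫ u in (0 : ℝ)..x, g u := by
  rw [intervalIntegral.integral_of_le x.2.1, intervalIntegral.integral_of_le x.2.1]
  exact integral_congr_ae (ae_restrict_of_ae_restrict_of_subset
    (Set.Ioc_subset_Icc_self.trans (Set.Icc_subset_Icc_right x.2.2)) h)

/-- In the white noise model, random signs in front of orthonormal functions cannot be detected
if the chi-square divergence, which is of order `n ^ 2 * a ^ 4 * N`, is small. -/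
theorem sum_measureReal_observation_le {Ω : Type*} [MeasurableSpace Ω] {P : Measure Ω}
    {β : ℝ≥0 → Ω → ℝ} (hβ : ∀ x, Measurable (β x)) (hB : IsPreBrownianReal β P) {n : ℕ}
    (hn : 1 ≤ n) {N : ℕ} {u : Fin N → ℝ → ℝ} (hu : ∀ k, MemLp (u k) 2 unitVolume)
    (horth : ∀ k k', pairing (u k) (u k') = if k = k' then 1 else 0) {a δ : ℝ} (hδ : 0 < δ)
    (ha : Real.exp ((Real.sqrt n * a) ^ 4 * N / 2) ≤ 1 + δ ^ 2) {f : (Fin N → Bool) → ℝ → ℝ}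
    (hf : ∀ b, f b =ᵐ[unitVolume] fun x ↦ ∑ k, a * sgn (b k) * u k x) {f₀ : ℝ → ℝ}
    (hf₀ : f₀ =ᵐ[unitVolume] 0) {A : Set (Set.Icc (0 : ℝ) 1 → ℝ)} (hA : MeasurableSet A) :
    ∑ b, P.real {ω | observation β (f b) n ω ∈ A} ≤
      2 ^ N * (P.real {ω | observation β f₀ n ω ∈ A} + δ) := by
  have hP : IsProbabilityMeasure P := hB.isGaussianProcess.isProbabilityMeasure
  have hs : Real.sqrt n ≠ 0 := by
    have : (0 : ℝ) < n := by exact_mod_cast hn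
    positivity
  have hψ : Orthonormal ℝ fun k ↦ (hu k).toLp (u k) := by
    rw [orthonormal_iff_ite]
    intro i j
    rw [pairing_eq_inner_toLp, horth]
  have hmap (g : ℝ → ℝ) {A : Set (Set.Icc (0 : ℝ) 1 → ℝ)} (hA : MeasurableSet A) :
      (P.map (observation β g n)).real A = P.real {ω | observation β g n ω ∈ A} := by
    rw [map_measureReal_apply (measurable_observation hβ g n) hA]
    rfl
  have (g : ℝ → ℝ) : IsProbabilityMeasure (P.map (observation β g n)) :=
    Measure.isProbabilityMeasure_map (measurable_observation hβ g n).aemeasurable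
  have key := sum_measureReal_le_of_cylinders (M := 2 ^ N) (δ := δ)
    (fun b ↦ P.map (observation β (f b) n)) (P.map (observation β f₀ n)) ?_ hA
  · simp_rw [hmap _ hA] at key
    exact key
  intro I S hS
  simp_rw [hmap _ hS.cylinder]
  have hG := (isGaussianGram_brownian hβ hB n I).sum_measureReal_sgn_le hψ hδ ha hS
  have h0 : {ω | observation β f₀ n ω ∈ cylinder I S} =
      {ω | (fun i : I ↦ (Real.sqrt n)⁻¹ * β (i.1 : ℝ).toNNReal ω) ∈ S} := by
    ext ω
    simp only [Set.mem_ofPred_eq, mem_cylinder]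
    have : I.restrict (observation β f₀ n ω) =
        fun i : I ↦ (Real.sqrt n)⁻¹ * β (i.1 : ℝ).toNNReal ω := by
      funext i
      rw [Finset.restrict, observation, intervalIntegral_congr_unitVolume hf₀]
      simp [div_eq_inv_mul]
    rw [this]
  have hb (b : Fin N → Bool) : {ω | observation β (f b) n ω ∈ cylinder I S} =
      {ω | (fun i : I ↦ ⟪intervalVec n i.1, ∑ k, (Real.sqrt n * a * sgn (b k)) •
        (hu k).toLp (u k)⟫ + (Real.sqrt n)⁻¹ * β (i.1 : ℝ).toNNReal ω) ∈ S} := by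
    have hae : ⇑(∑ k, (Real.sqrt n * a * sgn (b k)) • (hu k).toLp (u k) : Lp ℝ 2 unitVolume)
        =ᵐ[unitVolume] fun x ↦ Real.sqrt n * f b x := by
      have h1 : ∀ᵐ x ∂unitVolume, ∀ k, ((Real.sqrt n * a * sgn (b k)) • (hu k).toLp (u k) :
          Lp ℝ 2 unitVolume) x = Real.sqrt n * a * sgn (b k) * u k x := ae_all_iff.2 fun k ↦ by
        filter_upwards [Lp.coeFn_smul (Real.sqrt n * a * sgn (b k)) ((hu k).toLp (u k)),
          (hu k).coeFn_toLp] with x h2 h3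
        rw [h2, Pi.smul_apply, h3, smul_eq_mul]
      filter_upwards [hf b, h1, Lp.coeFn_fun_finsetSum Finset.univ fun k ↦
        (Real.sqrt n * a * sgn (b k)) • (hu k).toLp (u k)] with x hx h2 h3
      rw [h3, hx, Finset.mul_sum]
      exact Finset.sum_congr rfl fun k _ ↦ by rw [h2]; ring
    ext ω
    simp only [Set.mem_ofPred_eq, mem_cylinder]
    have : I.restrict (observation β (f b) n ω) =
        fun i : I ↦ ⟪intervalVec n i.1, ∑ k, (Real.sqrt n * a * sgn (b k)) •
        (hu k).toLp (u k)⟫ + (Real.sqrt n)⁻¹ * β (i.1 : ℝ).toNNReal ω := by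
      funext i
      rw [Finset.restrict, observation, inner_intervalVec,
        intervalIntegral_congr_unitVolume hae, intervalIntegral.integral_const_mul,
        inv_mul_cancel_left₀ hs, div_eq_inv_mul]
    rw [this]
  rw [h0]
  simp_rw [hb]
  exact hG

/-! ### Wavelet bumps -/

lemma pairing_comm (f g : ℝ → ℝ) : pairing f g = pairing g f := by
  simp only [pairing, mul_comm]

lemma pairing_congr_right {f g g' : ℝ → ℝ} (h : g =ᵐ[unitVolume] g') :
    pairing f g = pairing f g' := by
  refine integral_congr_ae ?_
  filter_upwards [h] with x hx
  rw [hx]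

/-- A function of norm one is square integrable: otherwise the integral would be `0` by
convention. -/
lemma memLp_two_of_pairing_self {f : ℝ → ℝ} (hf : Measurable f) (h : pairing f f = 1) :
    MemLp f 2 unitVolume := by
  rw [memLp_two_iff_integrable_sq hf.aestronglyMeasurable]
  by_contra hn
  have : pairing f f = 0 := by
    have h2 : (fun x ↦ f x * f x) = fun x ↦ f x ^ 2 := by funext x; ring
    rw [pairing, h2]
    exact integral_undef hn
  rw [this] at h
  exact zero_ne_one h

lemma pairing_sum_right {ι : Type*} [Fintype ι] {g : ℝ → ℝ} {u : ι → ℝ → ℝ}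
    (hg : MemLp g 2 unitVolume) (hu : ∀ k, MemLp (u k) 2 unitVolume) (c : ι → ℝ) :
    pairing g (fun x ↦ ∑ k, c k * u k x) = ∑ k, c k * pairing g (u k) := by
  have hi (k) : Integrable (fun x ↦ c k * (g x * u k x)) unitVolume :=
    (hg.integrable_mul (hu k)).const_mul _
  have h1 : (fun x ↦ g x * ∑ k, c k * u k x) = fun x ↦ ∑ k, c k * (g x * u k x) := by
    funext x
    rw [Finset.mul_sum]
    exact Finset.sum_congr rfl fun k _ ↦ by ring
  rw [pairing, h1, integral_finsetSum _ fun k _ ↦ hi k]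
  exact Finset.sum_congr rfl fun k _ ↦ integral_const_mul _ _

section Lp

variable {p : ℝ}

lemma integrable_coe (hp : 1 ≤ p) (F : LpUnit p) : Integrable F unitVolume :=
  (Lp.memLp F).integrable (by simpa using hp)

lemma integrable_mul_coe (hp : 1 ≤ p) {h : ℝ → ℝ} (hh : Measurable h) {M : ℝ}
    (hM : ∀ x ∈ Set.Icc (0 : ℝ) 1, |h x| ≤ M) (F : LpUnit p) :
    Integrable (fun x ↦ h x * F x) unitVolume :=
  (integrable_coe hp F).bdd_mul hh.aestronglyMeasurable
    ((ae_restrict_iff' measurableSet_Icc).2 (ae_of_all _ hM))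

lemma abs_pairing_le (hp : 1 ≤ p) {h : ℝ → ℝ} (hh : Measurable h) {M : ℝ}
    (hM : ∀ x ∈ Set.Icc (0 : ℝ) 1, |h x| ≤ M) (F : LpUnit p) : |pairing h F| ≤ M * ‖F‖ := by
  have hM0 : 0 ≤ M := (abs_nonneg _).trans (hM 0 (by simp))
  have h1 : |pairing h F| ≤ ∫ x, M * |F x| ∂unitVolume := by
    refine abs_integral_le_integral_abs.trans ?_
    refine integral_mono_ae (integrable_mul_coe hp hh hM F).abs
      ((integrable_coe hp F).abs.const_mul M) ?_
    refine (ae_restrict_iff' measurableSet_Icc).2 (ae_of_all _ fun x hx ↦ ?_)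
    simp only [abs_mul]
    exact mul_le_mul_of_nonneg_right (hM x hx) (abs_nonneg _)
  refine h1.trans ?_
  rw [integral_const_mul]
  refine mul_le_mul_of_nonneg_left ?_ hM0
  have h2 : ∫ x, |F x| ∂unitVolume = (eLpNorm F 1 unitVolume).toReal := by
    rw [eLpNorm_one_eq_lintegral_enorm, ← integral_norm_eq_lintegral_enorm
      (integrable_coe hp F).aestronglyMeasurable]
    simp
  rw [h2, Lp.norm_def]
  exact ENNReal.toReal_mono (Lp.eLpNorm_ne_top F) (eLpNorm_le_eLpNorm_of_exponent_le
    (by simpa using hp) (Lp.aestronglyMeasurable F))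

lemma pairing_sub (hp : 1 ≤ p) {h : ℝ → ℝ} (hh : Measurable h) {M : ℝ}
    (hM : ∀ x ∈ Set.Icc (0 : ℝ) 1, |h x| ≤ M) (F G : LpUnit p) :
    pairing h (F - G : LpUnit p) = pairing h F - pairing h G := by
  rw [pairing_congr_right (Lp.coeFn_sub F G), pairing, pairing, pairing,
    ← integral_sub (integrable_mul_coe hp hh hM F) (integrable_mul_coe hp hh hM G)]
  simp [mul_sub]

/-- If `C` lies in a ball of radius less than `τ`, then its points are at distance less than
`2 τ`. -/
lemma norm_sub_lt_of_diameter_lt (hp : 1 ≤ p) {C : Set (LpUnit p)} {τ : ℝ}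
    (h : diameter C < ENNReal.ofReal τ) {F G : LpUnit p} (hF : F ∈ C) (hG : G ∈ C) :
    ‖F - G‖ < 2 * τ := by
  have : Fact (1 ≤ ENNReal.ofReal p) := ⟨by simpa using hp⟩
  simp only [diameter, iInf_lt_iff] at h
  obtain ⟨r, ⟨g, hg⟩, hr⟩ := h
  have hr' : (r : ℝ) < τ := by
    rw [← ENNReal.ofReal_coe_nnreal] at hr
    exact (ENNReal.ofReal_lt_ofReal_iff_of_nonneg r.2).1 hr
  have h1 : ‖F - g‖ ≤ r := hg hF
  have h2 : ‖G - g‖ ≤ r := hg hG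
  have h3 : ‖F - G‖ ≤ ‖F - g‖ + ‖G - g‖ := by
    rw [← norm_neg (G - g)]
    refine le_trans (le_of_eq ?_) (norm_add_le _ _)
    congr 1
    abel
  linarith

end Lp

namespace WaveletBasis

variable {S : ℕ} (W : WaveletBasis S)

lemma measurable_psi (l : ℕ) (k : ℤ) : Measurable (W.psi l k) := by
  have := W.measurable_wav k
  unfold psi dilate
  fun_prop

lemma pairing_psi_psi {l : ℕ} (hl : 0 < l) {k : ℤ} (hk : k ∈ W.Z l) {l' : ℕ} (hl' : 0 < l')
    {k' : ℤ} (hk' : k' ∈ W.Z l') :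
    pairing (W.psi l k) (W.psi l' k') = if l = l' ∧ k = k' then 1 else 0 :=
  W.wav_wav l hl k hk l' hl' k' hk'

lemma memLp_psi {l : ℕ} (hl : 0 < l) {k : ℤ} (hk : k ∈ W.Z l) :
    MemLp (W.psi l k) 2 unitVolume :=
  memLp_two_of_pairing_self (W.measurable_psi l k) (by simp [W.pairing_psi_psi hl hk hl hk])

lemma memLp_scal {k : ℤ} (hk : k ∈ W.Z 0) : MemLp (W.scal k) 2 unitVolume :=
  memLp_two_of_pairing_self (W.measurable_scal k) (by simp [W.scal_scal k hk k hk])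

/-- The wavelets of level `j` are bounded by a multiple of `2 ^ (j / 2)`. -/
def IsBound (c : ℝ) : Prop :=
  ∀ j, 0 < j → ∀ k ∈ W.Z j, ∀ x ∈ Set.Icc (0 : ℝ) 1, |W.psi j k x| ≤ c * (2 : ℝ) ^ ((j : ℝ) / 2)

lemma exists_isBound : ∃ c, 1 ≤ c ∧ W.IsBound c := by
  obtain ⟨c, hc⟩ := W.sqrt_sum_le
  refine ⟨max c 1, le_max_right _ _, fun j hj k hk x hx ↦ ?_⟩
  refine le_trans ?_ ((hc x hx j).trans (by gcongr; exact le_max_left _ _))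
  refine Real.abs_le_sqrt ?_
  have h1 : W.psi j k x ^ 2 ≤ ∑ k ∈ W.Z j, W.psi j k x ^ 2 :=
    Finset.single_le_sum (f := fun k ↦ W.psi j k x ^ 2) (fun _ _ ↦ sq_nonneg _) hk
  have h2 : ∑ k ∈ W.Z j, W.psi j k x ^ 2 ≤
      ∑ l ∈ Finset.Ioc 0 j, ∑ k ∈ W.Z l, W.psi l k x ^ 2 :=
    Finset.single_le_sum (f := fun l ↦ ∑ k ∈ W.Z l, W.psi l k x ^ 2)
      (fun _ _ ↦ Finset.sum_nonneg fun _ _ ↦ sq_nonneg _) (Finset.mem_Ioc.2 ⟨hj, le_rfl⟩)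
  have h3 : 0 ≤ ∑ k ∈ W.Z 0, W.scal k x ^ 2 := Finset.sum_nonneg fun _ _ ↦ sq_nonneg _
  exact (h1.trans h2).trans (le_add_of_nonneg_left h3)

/-- Labels of interior wavelets whose supports are pairwise disjoint. -/
def node (q : ℕ) : ℤ := W.width + (2 * W.width + 1) * q

lemma node_injective : Function.Injective W.node := by
  intro q q' h
  simp only [node] at h
  have h1 : (2 * (W.width : ℤ) + 1) ≠ 0 := by positivity
  have h2 := mul_left_cancel₀ h1 (add_left_cancel h)
  exact_mod_cast h2

lemma node_mem {j : ℕ} (hj : 0 < j) {q : ℕ} (h : (2 * W.width + 1) * (q + 1) ≤ 2 ^ j) :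
    W.node q ∈ W.Z j := by
  have hz : (2 * (W.width : ℤ) + 1) * (q + 1) ≤ 2 ^ j := by exact_mod_cast h
  refine W.interior_mem j hj _ ?_ ?_
  · simp only [node]
    have : 0 ≤ (2 * (W.width : ℤ) + 1) * q := by positivity
    linarith
  · simp only [node]
    linarith

lemma eq_of_psi_node_ne_zero {j q q' : ℕ} {x : ℝ} (h : W.psi j (W.node q) x ≠ 0)
    (h' : W.psi j (W.node q') x ≠ 0) : q = q' := by
  have hx (q : ℕ) (h : W.psi j (W.node q) x ≠ 0) :
      |2 ^ j * x - (W.node q : ℝ)| ≤ W.width := by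
    by_contra hn
    refine h ?_
    rw [psi, dilate, W.wav_interior, W.mother_support _ (not_le.1 hn), mul_zero]
    simp only [node]
    have : 0 ≤ (2 * (W.width : ℤ) + 1) * q := by positivity
    linarith
  have h1 := abs_le.1 (hx q h)
  have h2 := abs_le.1 (hx q' h')
  simp only [node, Int.cast_add, Int.cast_mul, Int.cast_natCast, Int.cast_ofNat,
    Int.cast_one] at h1 h2
  have hw : (0 : ℝ) ≤ W.width := Nat.cast_nonneg _
  rcases lt_trichotomy q q' with hlt | heq | hlt
  · have : (q : ℝ) + 1 ≤ q' := by exact_mod_cast hlt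
    nlinarith
  · exact heq
  · have : (q' : ℝ) + 1 ≤ q := by exact_mod_cast hlt
    nlinarith

/-- The alternatives: sums of `N` wavelets of level `j` with disjoint supports and coefficients
`± a`. The index `i` selects a block of wavelets, and different blocks are disjoint. -/
noncomputable def bump (a : ℝ) (j N i : ℕ) (b : Fin N → Bool) (x : ℝ) : ℝ :=
  ∑ k : Fin N, a * sgn (b k) * W.psi j (W.node (i * N + k)) x

section bump

variable {W} {j N i i' : ℕ} {a : ℝ}

lemma measurable_bump (b : Fin N → Bool) : Measurable (W.bump a j N i b) := by
  have := W.measurable_psi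
  unfold bump
  fun_prop

lemma memLp_bump (hj : 0 < j) (hi : ∀ k : Fin N, W.node (i * N + k) ∈ W.Z j)
    (b : Fin N → Bool) : MemLp (W.bump a j N i b) 2 unitVolume :=
  memLp_finsetSum _ fun k _ ↦ (W.memLp_psi hj (hi k)).const_mul _

lemma abs_bump_one_le {c : ℝ} (hc0 : 0 ≤ c) (hc : W.IsBound c) (hj : 0 < j)
    (hi : ∀ k : Fin N, W.node (i * N + k) ∈ W.Z j) (b : Fin N → Bool) {x : ℝ}
    (hx : x ∈ Set.Icc (0 : ℝ) 1) : |W.bump 1 j N i b x| ≤ c * (2 : ℝ) ^ ((j : ℝ) / 2) := by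
  by_cases h : ∃ k : Fin N, W.psi j (W.node (i * N + k)) x ≠ 0
  · obtain ⟨k, hk⟩ := h
    have : W.bump 1 j N i b x = 1 * sgn (b k) * W.psi j (W.node (i * N + k)) x := by
      refine Finset.sum_eq_single k (fun k' _ hk' ↦ ?_) (by simp)
      by_contra hn
      have := W.eq_of_psi_node_ne_zero (right_ne_zero_of_mul hn) hk
      exact hk' (Fin.ext (by omega))
    rw [this, one_mul, abs_mul, abs_sgn, one_mul]
    exact hc j hj _ (hi k) x hx
  · push Not at h
    simp only [bump, h, mul_zero, Finset.sum_const_zero, abs_zero]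
    positivity

lemma pairing_bump (hj : 0 < j) (hi : ∀ k : Fin N, W.node (i * N + k) ∈ W.Z j) (b : Fin N → Bool)
    {g : ℝ → ℝ} (hg : MemLp g 2 unitVolume) : pairing g (W.bump a j N i b) =
      ∑ k : Fin N, a * sgn (b k) * pairing g (W.psi j (W.node (i * N + k))) :=
  pairing_sum_right hg (fun k ↦ W.memLp_psi hj (hi k)) _

lemma pairing_scal_bump (hj : 0 < j) (hi : ∀ k : Fin N, W.node (i * N + k) ∈ W.Z j)
    (b : Fin N → Bool) {k : ℤ} (hk : k ∈ W.Z 0) :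
    pairing (W.scal k) (W.bump a j N i b) = 0 := by
  rw [pairing_bump hj hi b (W.memLp_scal hk)]
  refine Finset.sum_eq_zero fun q _ ↦ ?_
  have : pairing (W.scal k) (W.psi j (W.node (i * N + q))) = 0 :=
    W.scal_wav k hk j hj _ (hi q)
  rw [this, mul_zero]

lemma pairing_psi_bump_of_ne (hj : 0 < j) (hi : ∀ k : Fin N, W.node (i * N + k) ∈ W.Z j)
    (b : Fin N → Bool) {l : ℕ} (hl : 0 < l) {k : ℤ} (hk : k ∈ W.Z l)
    (hn : l = j → ∀ q : Fin N, k ≠ W.node (i * N + q)) :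
    pairing (W.psi l k) (W.bump a j N i b) = 0 := by
  rw [pairing_bump hj hi b (W.memLp_psi hl hk)]
  refine Finset.sum_eq_zero fun q _ ↦ ?_
  rw [W.pairing_psi_psi hl hk hj (hi q), if_neg fun h ↦ hn h.1 q h.2, mul_zero]

lemma pairing_psi_node_bump (hj : 0 < j) (hi : ∀ k : Fin N, W.node (i * N + k) ∈ W.Z j)
    (b : Fin N → Bool) (q : Fin N) :
    pairing (W.psi j (W.node (i * N + q))) (W.bump a j N i b) = a * sgn (b q) := by
  rw [pairing_bump hj hi b (W.memLp_psi hj (hi q)), Finset.sum_eq_single q]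
  · simp [W.pairing_psi_psi hj (hi q) hj (hi q)]
  · intro q' _ hne
    rw [W.pairing_psi_psi hj (hi q) hj (hi q'), if_neg, mul_zero]
    rintro ⟨-, h⟩
    have := W.node_injective h
    exact hne (Fin.ext (by omega))
  · simp

lemma abs_pairing_psi_bump_le (hj : 0 < j) (hi : ∀ k : Fin N, W.node (i * N + k) ∈ W.Z j)
    (ha : 0 ≤ a) (b : Fin N → Bool) {k : ℤ} (hk : k ∈ W.Z j) :
    |pairing (W.psi j k) (W.bump a j N i b)| ≤ a := by
  by_cases h : ∃ q : Fin N, k = W.node (i * N + q)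
  · obtain ⟨q, rfl⟩ := h
    rw [pairing_psi_node_bump hj hi, abs_mul, abs_sgn, mul_one, abs_of_nonneg ha]
  · push Not at h
    rw [pairing_psi_bump_of_ne hj hi b hj hk fun _ ↦ h, abs_zero]
    exact ha

lemma pairing_bump_self (hj : 0 < j) (hi : ∀ k : Fin N, W.node (i * N + k) ∈ W.Z j)
    (b : Fin N → Bool) : pairing (W.bump 1 j N i b) (W.bump a j N i b) = a * N := by
  rw [pairing_bump hj hi b (memLp_bump hj hi b)]
  have (k : Fin N) : a * sgn (b k) *
      pairing (W.bump 1 j N i b) (W.psi j (W.node (i * N + k))) = a := by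
    rw [pairing_comm, pairing_psi_node_bump hj hi]
    linear_combination a * sgn_mul_self (b k)
  simp_rw [this]
  simp [mul_comm]

lemma pairing_bump_of_ne (hj : 0 < j) (hi : ∀ k : Fin N, W.node (i * N + k) ∈ W.Z j)
    (hi' : ∀ k : Fin N, W.node (i' * N + k) ∈ W.Z j) (hne : i ≠ i') (b b' : Fin N → Bool) :
    pairing (W.bump 1 j N i b) (W.bump a j N i' b') = 0 := by
  rw [pairing_bump hj hi' b' (memLp_bump hj hi b)]
  refine Finset.sum_eq_zero fun k _ ↦ ?_
  rw [pairing_comm, pairing_psi_bump_of_ne hj hi b hj (hi' k), mul_zero]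
  intro _ q h
  have h1 := W.node_injective h
  have h2 : (i' * N + k) / N = i' := by
    rw [mul_comm, Nat.mul_add_div (Fin.pos k), Nat.div_eq_of_lt k.2, add_zero]
  have h3 : (i * N + q) / N = i := by
    rw [mul_comm, Nat.mul_add_div (Fin.pos k), Nat.div_eq_of_lt q.2, add_zero]
  exact hne (by rw [← h3, ← h1, h2])

end bump

/-! ### Besov norms of the bumps -/

lemma besovNorm_congr (r p : ℝ) {f g : ℝ → ℝ} (h : f =ᵐ[unitVolume] g) :
    W.besovNorm r p f = W.besovNorm r p g := by
  simp only [besovNorm, scalNorm, levelNorm, pairing_congr_right h]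

lemma zero_mem_besovBall {p : ℝ} (hp : 1 ≤ p) (r B : ℝ) :
    (0 : LpUnit p) ∈ W.besovBall p r B := by
  have hp0 : p ≠ 0 := by positivity
  have h0 (g : ℝ → ℝ) : pairing g 0 = 0 := by simp [pairing]
  rw [besovBall, Set.mem_ofPred_eq, W.besovNorm_congr r p (Lp.coeFn_zero _ _ _)]
  simp [besovNorm, scalNorm, levelNorm, h0, Real.zero_rpow hp0, Real.zero_rpow (inv_ne_zero hp0)]

lemma besovNorm_bump_le {p r a B D : ℝ} {j N i : ℕ} (hp : 1 ≤ p) (hj : 0 < j)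
    (hi : ∀ k : Fin N, W.node (i * N + k) ∈ W.Z j) (ha : 0 ≤ a) (hD : 1 ≤ D)
    (hcard : ((W.Z j).card : ℝ) ≤ D * 2 ^ j)
    (hB : D * (a * (2 : ℝ) ^ ((j : ℝ) * (r + 1 / 2))) ≤ B) (b : Fin N → Bool) :
    W.besovNorm r p (W.bump a j N i b) ≤ ENNReal.ofReal B := by
  have hp0 : 0 < p := by positivity
  refine max_le ?_ (iSup₂_le fun l hl ↦ ENNReal.ofReal_le_ofReal ?_)
  · have : W.scalNorm p (W.bump a j N i b) = 0 := by
      rw [scalNorm, Finset.sum_eq_zero, Real.zero_rpow (one_div_ne_zero hp0.ne')]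
      intro k hk
      rw [pairing_scal_bump hj hi b hk, abs_zero, Real.zero_rpow hp0.ne']
    simp [this]
  · have hB0 : 0 ≤ B := le_trans (by positivity) hB
    by_cases hlj : l = j
    · subst hlj
      have h1 : W.levelNorm p l (W.bump a l N i b) ≤ D * (2 : ℝ) ^ ((l : ℝ) / p) * a := by
        have h2 : ∑ k ∈ W.Z l, |pairing (W.psi l k) (W.bump a l N i b)| ^ p ≤
            (D * 2 ^ l) * a ^ p := by
          refine (Finset.sum_le_card_nsmul _ _ (a ^ p) fun k hk ↦ ?_).trans ?_
          · exact Real.rpow_le_rpow (abs_nonneg _) (abs_pairing_psi_bump_le hl hi ha b hk) hp0.le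
          · rw [nsmul_eq_mul]
            gcongr
        refine (Real.rpow_le_rpow (Finset.sum_nonneg fun _ _ ↦ by positivity) h2
          (by positivity)).trans ?_
        rw [Real.mul_rpow (by positivity) (by positivity), Real.mul_rpow (by positivity)
          (by positivity), ← Real.rpow_mul ha, mul_one_div_cancel hp0.ne', Real.rpow_one,
          ← Real.rpow_natCast, ← Real.rpow_mul zero_le_two, mul_one_div]
        gcongr
        exact Real.rpow_le_self_of_one_le hD ((div_le_one hp0).2 hp)
      calc _ ≤ (2 : ℝ) ^ ((l : ℝ) * (r + 1 / 2 - 1 / p)) * (D * (2 : ℝ) ^ ((l : ℝ) / p) * a) := by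
            gcongr
        _ = D * (a * ((2 : ℝ) ^ ((l : ℝ) * (r + 1 / 2 - 1 / p)) * (2 : ℝ) ^ ((l : ℝ) / p))) := by
            ring
        _ = D * (a * (2 : ℝ) ^ ((l : ℝ) * (r + 1 / 2))) := by
            rw [← Real.rpow_add two_pos]
            congr 3
            ring
        _ ≤ B := hB
    · have : W.levelNorm p l (W.bump a j N i b) = 0 := by
        rw [levelNorm, Finset.sum_eq_zero, Real.zero_rpow (one_div_ne_zero hp0.ne')]
        intro k hk
        rw [pairing_psi_bump_of_ne hj hi b hl hk fun h ↦ absurd h hlj, abs_zero,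
          Real.zero_rpow hp0.ne']
      rw [this, mul_zero]
      exact hB0

lemma sum_abs_pairing_le {p s B D : ℝ} {j : ℕ} (hp : 1 ≤ p) (hj : 0 < j) (hB : 0 ≤ B) (hD : 1 ≤ D)
    (hcard : ((W.Z j).card : ℝ) ≤ D * 2 ^ j) {G : LpUnit p} (hG : G ∈ W.besovBall p s B) :
    ∑ k ∈ W.Z j, |pairing (W.psi j k) G| ≤ D * B * (2 : ℝ) ^ ((j : ℝ) * (1 / 2 - s)) := by
  have hp0 : 0 < p := by positivity
  have h1 : (2 : ℝ) ^ ((j : ℝ) * (s + 1 / 2 - 1 / p)) * W.levelNorm p j G ≤ B := by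
    rw [← ENNReal.ofReal_le_ofReal_iff hB]
    refine le_trans ?_ hG
    exact le_max_of_le_right (le_iSup₂_of_le j hj le_rfl)
  have h2 : ∑ k ∈ W.Z j, |pairing (W.psi j k) G| ≤
      ((W.Z j).card : ℝ) ^ ((p - 1) / p) * W.levelNorm p j G := by
    have h3 := Real.rpow_sum_le_const_mul_sum_rpow (W.Z j) (fun k ↦ pairing (W.psi j k) G) hp
    have h4 := Real.rpow_le_rpow (by positivity) h3 (z := 1 / p) (by positivity)
    rw [← Real.rpow_mul (by positivity), mul_one_div_cancel hp0.ne', Real.rpow_one,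
      Real.mul_rpow (by positivity) (by positivity), ← Real.rpow_mul (by positivity),
      mul_one_div] at h4
    exact h4
  have h5 : ((W.Z j).card : ℝ) ^ ((p - 1) / p) ≤ D * (2 : ℝ) ^ ((j : ℝ) * ((p - 1) / p)) := by
    have he : 0 ≤ (p - 1) / p := div_nonneg (by linarith) hp0.le
    refine (Real.rpow_le_rpow (by positivity) hcard he).trans ?_
    rw [Real.mul_rpow (by positivity) (by positivity), ← Real.rpow_natCast,
      ← Real.rpow_mul zero_le_two]
    gcongr
    exact Real.rpow_le_self_of_one_le hD ((div_le_one hp0).2 (by linarith))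
  have h6 : W.levelNorm p j G ≤ B * (2 : ℝ) ^ (-((j : ℝ) * (s + 1 / 2 - 1 / p))) := by
    rw [Real.rpow_neg zero_le_two, ← div_eq_mul_inv, le_div_iff₀ (by positivity), mul_comm]
    exact h1
  have h7 : 0 ≤ W.levelNorm p j G := by unfold levelNorm; positivity
  calc _ ≤ _ := h2
    _ ≤ (D * (2 : ℝ) ^ ((j : ℝ) * ((p - 1) / p))) *
        (B * (2 : ℝ) ^ (-((j : ℝ) * (s + 1 / 2 - 1 / p)))) := by gcongr
    _ = D * B * ((2 : ℝ) ^ ((j : ℝ) * ((p - 1) / p)) *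
        (2 : ℝ) ^ (-((j : ℝ) * (s + 1 / 2 - 1 / p)))) := by ring
    _ = _ := by
      rw [← Real.rpow_add two_pos]
      congr 2
      field_simp
      ring

end WaveletBasis

/-! ### Separation of the bumps, and disjoint events -/

namespace WaveletBasis

variable {S : ℕ} {W : WaveletBasis S}

lemma abs_pairing_bump_coe_le {p s B D c : ℝ} {j N i : ℕ} (hp : 1 ≤ p) (hj : 0 < j)
    (hi : ∀ k : Fin N, W.node (i * N + k) ∈ W.Z j) (hB : 0 ≤ B) (hD : 1 ≤ D)
    (hcard : ((W.Z j).card : ℝ) ≤ D * 2 ^ j) (hc : W.IsBound c) (b : Fin N → Bool)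
    {G : LpUnit p} (hG : G ∈ W.besovBall p s B) :
    |pairing (W.bump 1 j N i b) G| ≤ D * B * (2 : ℝ) ^ ((j : ℝ) * (1 / 2 - s)) := by
  have h1 : pairing (W.bump 1 j N i b) G =
      ∑ k : Fin N, 1 * sgn (b k) * pairing (W.psi j (W.node (i * N + k))) G := by
    have hint (k : Fin N) :=
      (integrable_mul_coe hp (W.measurable_psi j _) (hc j hj _ (hi k)) G).const_mul
        (1 * sgn (b k))
    simp_rw [pairing, bump, Finset.sum_mul, mul_assoc] at hint ⊢
    rw [integral_finsetSum _ fun k _ ↦ hint k]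
    simp_rw [integral_const_mul]
  rw [h1]
  refine (Finset.abs_sum_le_sum_abs _ _).trans
    (le_trans ?_ (W.sum_abs_pairing_le hp hj hB hD hcard hG))
  have h2 : ∑ k : Fin N, |1 * sgn (b k) * pairing (W.psi j (W.node (i * N + k))) G| =
      ∑ l ∈ Finset.univ.map ⟨fun k : Fin N ↦ W.node (i * N + k), fun k k' h ↦
        Fin.ext (by have := W.node_injective h; omega)⟩, |pairing (W.psi j l) G| := by
    rw [Finset.sum_map]
    refine Finset.sum_congr rfl fun k _ ↦ ?_
    simp only [one_mul, abs_mul, abs_sgn]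
    rfl
  rw [h2]
  refine Finset.sum_le_sum_of_subset_of_nonneg (fun l hl ↦ ?_) fun _ _ _ ↦ abs_nonneg _
  obtain ⟨k, -, rfl⟩ := Finset.mem_map.1 hl
  exact hi k

/-- A bump is far from a Besov ball of higher smoothness: test the difference against the bump
itself, which is bounded because its wavelets have disjoint supports. -/
lemma le_norm_bump_sub {p s a B D c : ℝ} {j N i : ℕ} (hp : 1 ≤ p) (hj : 0 < j)
    (hi : ∀ k : Fin N, W.node (i * N + k) ∈ W.Z j) (hB : 0 ≤ B) (hD : 1 ≤ D)
    (hcard : ((W.Z j).card : ℝ) ≤ D * 2 ^ j) (hc0 : 0 ≤ c) (hc : W.IsBound c)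
    (b : Fin N → Bool) {F G : LpUnit p} (hF : F =ᵐ[unitVolume] W.bump a j N i b)
    (hG : G ∈ W.besovBall p s B) :
    a * N ≤ c * (2 : ℝ) ^ ((j : ℝ) / 2) * ‖F - G‖ +
      D * B * (2 : ℝ) ^ ((j : ℝ) * (1 / 2 - s)) := by
  have hb := fun x hx ↦ abs_bump_one_le hc0 hc hj hi b (x := x) hx
  have h1 := abs_pairing_le hp (measurable_bump b) hb (F - G)
  rw [pairing_sub hp (measurable_bump b) hb, pairing_congr_right hF, pairing_bump_self hj hi] at h1
  have h2 := abs_pairing_bump_coe_le hp hj hi hB hD hcard hc b hG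
  have h3 := (abs_le.1 h1).2
  have h4 := (abs_le.1 h2).2
  linarith

lemma le_norm_bump_sub_bump {p a c : ℝ} {j N i i' : ℕ} (hp : 1 ≤ p) (hj : 0 < j)
    (hi : ∀ k : Fin N, W.node (i * N + k) ∈ W.Z j)
    (hi' : ∀ k : Fin N, W.node (i' * N + k) ∈ W.Z j) (hne : i ≠ i') (hc0 : 0 ≤ c)
    (hc : W.IsBound c) (b b' : Fin N → Bool) {F F' : LpUnit p}
    (hF : F =ᵐ[unitVolume] W.bump a j N i b) (hF' : F' =ᵐ[unitVolume] W.bump a j N i' b') :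
    a * N ≤ c * (2 : ℝ) ^ ((j : ℝ) / 2) * ‖F - F'‖ := by
  have hb := fun x hx ↦ abs_bump_one_le hc0 hc hj hi b (x := x) hx
  have h1 := abs_pairing_le hp (measurable_bump b) hb (F - F')
  rw [pairing_sub hp (measurable_bump b) hb, pairing_congr_right hF, pairing_congr_right hF',
    pairing_bump_self hj hi, pairing_bump_of_ne hj hi hi' hne, sub_zero] at h1
  exact (le_abs_self _).trans h1

end WaveletBasis

/-- A confidence set that is small under the zero function cannot cover `m` well separated groups
of alternatives, each of which is indistinguishable from the zero function on average: the events
that the set is small and meets the `i`-th group are disjoint, and each of them has probability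
at least `1 - 2 α - δ` under the zero function. -/
lemma mul_le_one_of_separated {Ω : Type*} [MeasurableSpace Ω] {P : Measure Ω}
    {β : ℝ≥0 → Ω → ℝ} (hβ : ∀ x, Measurable (β x)) (hB : IsPreBrownianReal β P) {n : ℕ}
    (hn : 1 ≤ n) {p : ℝ} (hp : 1 ≤ p) {m N : ℕ} {u : Fin m → Fin N → ℝ → ℝ}
    (hu : ∀ i k, MemLp (u i k) 2 unitVolume)
    (horth : ∀ i k k', pairing (u i k) (u i k') = if k = k' then 1 else 0) {a α δ τ : ℝ}
    (hα : 0 ≤ α) (hδ : 0 < δ) (ha : Real.exp ((Real.sqrt n * a) ^ 4 * N / 2) ≤ 1 + δ ^ 2)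
    {F : Fin m → (Fin N → Bool) → LpUnit p}
    (hF : ∀ i b, F i b =ᵐ[unitVolume] fun x ↦ ∑ k, a * sgn (b k) * u i k x)
    (hsep : ∀ i i', i ≠ i' → ∀ b b', 2 * τ ≤ ‖F i b - F i' b'‖)
    {C : (Set.Icc (0 : ℝ) 1 → ℝ) → Set (LpUnit p)}
    (hdm : MeasurableSet {y | ENNReal.ofReal τ ≤ diameter (C y)})
    (hd : P {ω | ENNReal.ofReal τ ≤ diameter (C (observation β (0 : LpUnit p) n ω))} ≤
      ENNReal.ofReal α)
    (hCm : ∀ i b, MeasurableSet {y | F i b ∈ C y})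
    (hC : ∀ i b, ENNReal.ofReal (1 - α) ≤ P {ω | F i b ∈ C (observation β (F i b) n ω)}) :
    m * (1 - 2 * α - δ) ≤ 1 := by
  have hP : IsProbabilityMeasure P := hB.isGaussianProcess.isProbabilityMeasure
  set A : Fin m → Set (Set.Icc (0 : ℝ) 1 → ℝ) := fun i ↦ ⋃ b, {y | F i b ∈ C y} with hA
  have hAm (i) : MeasurableSet (A i) := MeasurableSet.iUnion (hCm i)
  set Y := observation β (0 : LpUnit p) n with hY
  have hYm : Measurable Y := measurable_observation hβ _ n
  set E := {ω | ENNReal.ofReal τ ≤ diameter (C (Y ω))} with hE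
  have hEm : MeasurableSet E := hYm hdm
  have hEα : P.real E ≤ α := ENNReal.toReal_le_of_le_ofReal hα hd
  have hPA (i) : 1 - α - δ ≤ P.real (Y ⁻¹' A i) := by
    have h1 := sum_measureReal_observation_le hβ hB hn (hu i) (horth i) hδ ha (hF i)
      (Lp.coeFn_zero ℝ (ENNReal.ofReal p) unitVolume) (hAm i)
    have h2 (b) : 1 - α ≤ P.real {ω | observation β (F i b) n ω ∈ A i} := by
      have h3 : P.real {ω | F i b ∈ C (observation β (F i b) n ω)} ≤
          P.real {ω | observation β (F i b) n ω ∈ A i} :=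
        measureReal_mono fun ω hω ↦ Set.mem_iUnion.2 ⟨b, hω⟩
      refine le_trans ?_ h3
      rw [Measure.real, ← ENNReal.ofReal_le_iff_le_toReal (measure_ne_top _ _)]
      exact hC i b
    have h4 : (2 : ℝ) ^ N * (1 - α) ≤ ∑ b, P.real {ω | observation β (F i b) n ω ∈ A i} := by
      refine le_trans (le_of_eq ?_) (Finset.sum_le_sum fun b _ ↦ h2 b)
      simp only [Finset.sum_const, Finset.card_univ, Fintype.card_pi, Fintype.card_bool,
        Finset.prod_const, Fintype.card_fin, nsmul_eq_mul, Nat.cast_pow, Nat.cast_ofNat]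
    have h5 := le_of_mul_le_mul_left (h4.trans h1) (by positivity)
    have h6 : P.real {ω | observation β (0 : LpUnit p) n ω ∈ A i} = P.real (Y ⁻¹' A i) := rfl
    linarith
  have hT (i) : 1 - 2 * α - δ ≤ P.real (Y ⁻¹' A i \ E) := by
    have := le_measureReal_sdiff (μ := P) (s₁ := Y ⁻¹' A i) (s₂ := E)
    linarith [hPA i]
  have hdisj : Pairwise (Function.onFun Disjoint fun i ↦ Y ⁻¹' A i \ E) := by
    intro i i' hne
    refine Set.disjoint_left.2 fun ω hω hω' ↦ ?_
    obtain ⟨b, hb⟩ := Set.mem_iUnion.1 hω.1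
    obtain ⟨b', hb'⟩ := Set.mem_iUnion.1 hω'.1
    exact absurd (norm_sub_lt_of_diameter_lt hp (not_le.1 hω.2) hb hb')
      (not_lt.2 (hsep i i' hne b b'))
  calc (m : ℝ) * (1 - 2 * α - δ) = ∑ _i : Fin m, (1 - 2 * α - δ) := by
        rw [Finset.sum_const, Finset.card_univ, Fintype.card_fin, nsmul_eq_mul]
    _ ≤ ∑ i, P.real (Y ⁻¹' A i \ E) := Finset.sum_le_sum fun i _ ↦ hT i
    _ = P.real (⋃ i, Y ⁻¹' A i \ E) :=
      (measureReal_iUnion_fintype hdisj fun i ↦ (hYm (hAm i)).diff hEm).symm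
    _ ≤ 1 := measureReal_le_one

lemma exp_half_le {ε : ℝ} (h0 : 0 ≤ ε) (h1 : ε ≤ 1) : Real.exp (ε / 2) ≤ 1 + ε := by
  have h2 := Real.one_sub_le_exp_neg (ε / 2)
  have h3 : Real.exp (ε / 2) * Real.exp (-(ε / 2)) = 1 := by rw [← Real.exp_add]; simp
  have h4 := Real.exp_pos (ε / 2)
  nlinarith

/-- Decay rates in `n` and in the resolution level agree up to a factor `2` if `n` is the integer
part of `x`. -/
lemma floor_rpow_neg_le {x e : ℝ} (hx : 1 ≤ x) (h0 : 0 ≤ e) (h1 : e ≤ 1) :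
    ((⌊x⌋₊ : ℕ) : ℝ) ^ (-e) ≤ 2 * x ^ (-e) := by
  have hn : (1 : ℝ) ≤ ⌊x⌋₊ := by exact_mod_cast Nat.floor_pos.2 hx
  have hx2 : x / 2 ≤ ⌊x⌋₊ := by
    have := Nat.lt_floor_add_one x
    linarith
  refine (Real.rpow_le_rpow_of_nonpos (by positivity) hx2 (by linarith)).trans ?_
  rw [Real.div_rpow (by positivity) zero_le_two, Real.rpow_neg zero_le_two, div_inv_eq_mul,
    mul_comm]
  gcongr
  exact Real.rpow_le_self_of_one_le one_le_two h1

lemma eventually_mul_rpow_neg_le {A η ε : ℝ} (hη : 0 < η) (hε : 0 < ε) :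
    ∀ᶠ j : ℕ in Filter.atTop, A * (2 : ℝ) ^ (-((j : ℝ) * η)) ≤ ε := by
  have h1 : Filter.Tendsto (fun j : ℕ ↦ (2 : ℝ) ^ (-((j : ℝ) * η))) Filter.atTop (nhds 0) := by
    have h2 := (tendsto_rpow_atTop_of_base_gt_one 2 one_lt_two).comp
      (tendsto_natCast_atTop_atTop.atTop_mul_const hη)
    have h3 := h2.inv_tendsto_atTop
    refine h3.congr fun j ↦ ?_
    simp [Real.rpow_neg]
  have h4 := h1.const_mul A
  rw [mul_zero] at h4
  exact (h4.eventually_lt_const hε).mono fun _ h ↦ h.le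

end HonestSets

theorem mainTheorem7 {S : ℕ} (W : HonestSets.WaveletBasis S)
    (p : ℝ) (hp1 : 1 ≤ p) (hp2 : p ≤ 2) (B : ℝ) (hB : 0 < B)
    (α : ℝ) (hα : 0 < α) (hα' : α < 1 / 2) :
    ∃ υ₀ : ℝ, 0 < υ₀ ∧ ∀ υ : ℝ, 0 < υ → υ ≤ υ₀ →
      ∀ s t : ℝ, s < S → 2 * t < s → 1 / p ≤ 2 * t →
      ∀ (Ω : Type*) [MeasurableSpace Ω] (P : Measure Ω) (β : ℝ≥0 → Ω → ℝ),
        (∀ x, Measurable (β x)) → IsBrownianReal β P →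
        ¬ ∃ C : ℕ → (Set.Icc (0 : ℝ) 1 → ℝ) → Set (HonestSets.LpUnit p),
          HonestSets.IsHonestAdaptive W P β p α B {s, t}
            (fun n => HonestSets.model W p t s B
              (υ * (n : ℝ) ^ (-(t / (2 * t + 1 / 2))))) C := by
  open HonestSets HonestSets.WaveletBasis in
  obtain ⟨c, hc1, hc⟩ := W.exists_isBound
  have hc0 : 0 < c := by positivity
  obtain ⟨D, hD1, hD⟩ : ∃ D : ℝ, 1 ≤ D ∧ ∀ l, ((W.Z l).card : ℝ) ≤ D * 2 ^ l := by
    obtain ⟨D, hD⟩ := W.card_le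
    exact ⟨max D 1, le_max_right _ _, fun l ↦ (hD l).trans (by gcongr; exact le_max_left _ _)⟩
  have hD0 : 0 < D := by positivity
  -- `δ` is the slack in `m (1 - 2 α - δ) ≤ 1`, and `m` is so large that this fails.
  set δ : ℝ := (1 - 2 * α) / 2 with hδ
  have hδ0 : 0 < δ := by rw [hδ]; linarith
  have hδ1 : δ ≤ 1 := by rw [hδ]; linarith
  obtain ⟨m, hm⟩ := exists_nat_gt (1 / δ)
  rw [div_lt_iff₀ hδ0] at hm
  -- The factor `2 ^ j₀` by which `N` falls short of `2 ^ j` makes room for `m` blocks of wavelets.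
  set j₀ : ℕ := (2 * W.width + 1) * m with hj₀
  have hj₀m : (2 * W.width + 1) * m ≤ 2 ^ j₀ := Nat.lt_two_pow_self.le
  set κ : ℝ := 2 ^ j₀ with hκ
  have hκ0 : 0 < κ := by positivity
  -- `ε ≤ B / D` keeps the bumps in `Σ(t, B)`, and `ε ≤ δ` bounds the chi-square divergence.
  set ε : ℝ := min (B / D) δ with hε
  have hε0 : 0 < ε := lt_min (by positivity) hδ0
  have hεδ : ε ≤ δ := min_le_right _ _
  have hεB : D * ε ≤ B := by
    rw [mul_comm, ← le_div_iff₀ hD0]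
    exact min_le_left _ _
  set γ : ℝ := ε / (2 * κ * c) with hγ
  have hγ0 : 0 < γ := by positivity
  have hγε : 2 * (c * γ) = ε / κ := by rw [hγ]; field_simp
  refine ⟨γ / 2, by positivity, ?_⟩
  rintro υ hυ0 hυ s t - hts htp Ω _ P β hβ hBr ⟨C, L, hCL⟩
  have ht0 : 0 < t := by
    have : 0 < 1 / p := by positivity
    linarith
  have hs0 : 0 < s := by linarith
  have hst : t < s := by linarith
  set θ : ℝ := 2 * t + 1 / 2 with hθ
  have hθ0 : 0 < θ := by positivity
  set e : ℝ := s / (2 * s + 1) with he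
  have he0 : 0 ≤ e := by positivity
  have he1 : e ≤ 1 := by rw [he, div_le_one (by positivity)]; linarith
  have hη : 0 < θ * e - t := by
    have : θ * e - t = (s / 2 - t) / (2 * s + 1) := by rw [hθ, he]; field_simp; ring
    rw [this]
    exact div_pos (by linarith) (by positivity)
  -- At level `j` the ball `Σ(s, B)` and the diameter `L n ^ (-s / (2 s + 1))` are negligible
  -- compared with the norm `2 ^ (-j t)` of a bump.
  obtain ⟨j, hj0, hjj, hjs, hjL⟩ : ∃ j : ℕ, 0 < j ∧ j₀ ≤ j ∧
      D * B * (2 : ℝ) ^ (-((j : ℝ) * (s - t))) ≤ c * γ ∧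
      4 * |L| * (2 : ℝ) ^ (-((j : ℝ) * (θ * e - t))) ≤ γ :=
    ((Filter.eventually_gt_atTop 0).and ((Filter.eventually_ge_atTop j₀).and
      ((eventually_mul_rpow_neg_le (sub_pos.2 hst) (by positivity)).and
      (eventually_mul_rpow_neg_le hη hγ0)))).exists
  set N : ℕ := 2 ^ (j - j₀) with hN
  have hNj : 2 ^ j₀ * N = 2 ^ j := by rw [hN, ← pow_add, Nat.add_sub_cancel' hjj]
  have hNr : κ * (N : ℝ) = (2 : ℝ) ^ (j : ℝ) := by
    rw [Real.rpow_natCast, hκ]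
    exact_mod_cast hNj
  have hnode (i : Fin m) (k : Fin N) : W.node (i * N + k) ∈ W.Z j := by
    refine W.node_mem hj0 ?_
    have h1 : (i : ℕ) * N + k + 1 ≤ m * N := by
      have := Nat.mul_le_mul_right N i.2
      have := k.2
      rw [Nat.succ_eq_add_one, add_mul] at *
      omega
    calc _ ≤ (2 * W.width + 1) * (m * N) := Nat.mul_le_mul_left _ h1
      _ ≤ 2 ^ j₀ * N := by rw [← mul_assoc]; exact Nat.mul_le_mul_right _ hj₀m
      _ = 2 ^ j := hNj
  set x : ℝ := (2 : ℝ) ^ ((j : ℝ) * θ) with hx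
  have hx1 : 1 ≤ x := Real.one_le_rpow one_le_two (by positivity)
  -- The noise level at which bumps of level `j` become undetectable.
  set n : ℕ := ⌊x⌋₊ with hn
  have hn1 : 1 ≤ n := Nat.floor_pos.2 hx1
  have hnx : (n : ℝ) ≤ x := Nat.floor_le (by positivity)
  have hxpow (r : ℝ) : x ^ (-r) = (2 : ℝ) ^ (-((j : ℝ) * (θ * r))) := by
    rw [hx, ← Real.rpow_mul zero_le_two]
    ring_nf
  set a : ℝ := ε * (2 : ℝ) ^ (-((j : ℝ) * (t + 1 / 2))) with ha
  have ha0 : 0 ≤ a := by positivity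
  set z : ℝ := (2 : ℝ) ^ (-((j : ℝ) * t)) with hz
  have hz0 : 0 < z := by positivity
  set h : ℝ := (2 : ℝ) ^ ((j : ℝ) / 2) with hh
  have hh0 : 0 < h := by positivity
  have haN : a * N = h * (2 * (c * γ) * z) := by
    have h1 : (2 : ℝ) ^ (-((j : ℝ) * (t + 1 / 2))) * (2 : ℝ) ^ (j : ℝ) = h * z := by
      rw [hh, hz, ← Real.rpow_add two_pos, ← Real.rpow_add two_pos]
      ring_nf
    have h2 : (N : ℝ) = (2 : ℝ) ^ (j : ℝ) / κ := by rw [← hNr, mul_div_cancel_left₀ _ hκ0.ne']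
    rw [hγε, ha, h2]
    linear_combination ε / κ * h1
  set F : Fin m → (Fin N → Bool) → LpUnit p := fun i b ↦
    ((memLp_bump (a := a) hj0 (hnode i) b).mono_exponent (p := ENNReal.ofReal p)
      (ENNReal.ofReal_le_of_le_toReal (by simpa using hp2))).toLp _ with hFdef
  have hF (i : Fin m) (b : Fin N → Bool) : F i b =ᵐ[unitVolume] W.bump a j N i b :=
    MemLp.coeFn_toLp _
  have hFt (i : Fin m) (b : Fin N → Bool) : F i b ∈ W.besovBall p t B := by
    rw [besovBall, Set.mem_ofPred_eq, W.besovNorm_congr t p (hF i b)]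
    refine W.besovNorm_bump_le hp1 hj0 (hnode i) ha0 hD1 (hD j) (le_trans (le_of_eq ?_) hεB) b
    rw [ha, mul_assoc, ← Real.rpow_add two_pos]
    simp
  have hFs (i : Fin m) (b : Fin N → Bool) (G : LpUnit p) (hG : G ∈ W.besovBall p s B) :
      γ * z ≤ ‖F i b - G‖ := by
    have h1 := le_norm_bump_sub hp1 hj0 (hnode i) hB.le hD1 (hD j) hc0.le hc b (hF i b) hG
    rw [haN] at h1
    have h2 : D * B * (2 : ℝ) ^ ((j : ℝ) * (1 / 2 - s)) =
        h * (D * B * (2 : ℝ) ^ (-((j : ℝ) * (s - t))) * z) := by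
      have : (2 : ℝ) ^ ((j : ℝ) * (1 / 2 - s)) = h * ((2 : ℝ) ^ (-((j : ℝ) * (s - t))) * z) := by
        rw [hh, hz, ← Real.rpow_add two_pos, ← Real.rpow_add two_pos]
        ring_nf
      rw [this]
      ring
    have h3 := mul_le_mul_of_nonneg_right hjs hz0.le
    rw [h2] at h1
    have h4 : h * (2 * (c * γ) * z) ≤ h * (c * ‖F i b - G‖ + c * γ * z) := by
      refine h1.trans ?_
      have := mul_le_mul_of_nonneg_left h3 hh0.le
      linarith
    have h5 := le_of_mul_le_mul_left h4 hh0
    refine le_of_mul_le_mul_left (a := c) ?_ hc0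
    linarith
  have hFmodel (i : Fin m) (b : Fin N → Bool) :
      F i b ∈ model W p t s B (υ * (n : ℝ) ^ (-(t / θ))) := by
    refine ⟨Or.inl ⟨hFt i b, ?_⟩,
      (memLp_congr_ae (hF i b)).2 (memLp_bump hj0 (hnode i) b)⟩
    have : Nonempty (W.besovBall p s B) := ⟨⟨0, W.zero_mem_besovBall hp1 s B⟩⟩
    refine le_ciInf fun G ↦ le_trans ?_ (hFs i b G G.2)
    have h1 : (n : ℝ) ^ (-(t / θ)) ≤ 2 * z := by
      refine (floor_rpow_neg_le hx1 (by positivity) ?_).trans_eq ?_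
      · rw [div_le_one hθ0]; linarith
      · rw [hxpow, mul_div_cancel₀ _ hθ0.ne']
    calc υ * (n : ℝ) ^ (-(t / θ)) ≤ γ / 2 * (2 * z) := by gcongr
      _ = γ * z := by ring
  have hsep (i i' : Fin m) (hne : i ≠ i') (b b' : Fin N → Bool) :
      2 * (L * (n : ℝ) ^ (-e)) ≤ ‖F i b - F i' b'‖ := by
    have h1 := le_norm_bump_sub_bump hp1 hj0 (hnode i) (hnode i')
      (fun h ↦ hne (Fin.ext h)) hc0.le hc b b' (hF i b) (hF i' b')
    rw [haN] at h1
    replace h1 : h * (2 * (c * γ) * z) ≤ h * (c * ‖F i b - F i' b'‖) :=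
      h1.trans_eq (by rw [hh]; ring)
    have h2 : γ * z ≤ ‖F i b - F i' b'‖ := by
      refine le_of_mul_le_mul_left (a := c) ?_ hc0
      have h3 := le_of_mul_le_mul_left h1 hh0
      have : 0 < c * γ * z := by positivity
      linarith
    refine le_trans ?_ h2
    have h3 : (n : ℝ) ^ (-e) ≤ 2 * ((2 : ℝ) ^ (-((j : ℝ) * (θ * e - t))) * z) := by
      refine (floor_rpow_neg_le hx1 he0 he1).trans_eq ?_
      rw [hxpow, hz, ← Real.rpow_add two_pos]
      ring_nf
    calc 2 * (L * (n : ℝ) ^ (-e)) ≤ 2 * (|L| * (n : ℝ) ^ (-e)) := by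
          gcongr
          exact le_abs_self L
      _ ≤ 2 * (|L| * (2 * ((2 : ℝ) ^ (-((j : ℝ) * (θ * e - t))) * z))) := by gcongr
      _ = 4 * |L| * (2 : ℝ) ^ (-((j : ℝ) * (θ * e - t))) * z := by ring
      _ ≤ γ * z := by gcongr
  have hchi : Real.exp ((Real.sqrt n * a) ^ 4 * N / 2) ≤ 1 + δ ^ 2 := by
    have h1 : (Real.sqrt n * a) ^ 4 * N ≤ ε ^ 4 := by
      have h2 : (Real.sqrt n) ^ 4 = (n : ℝ) ^ 2 := by
        rw [show 4 = 2 * 2 from rfl, pow_mul, Real.sq_sqrt (Nat.cast_nonneg _)]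
      have h3 : (N : ℝ) ≤ (2 : ℝ) ^ (j : ℝ) := by
        rw [← hNr]
        exact le_mul_of_one_le_left (Nat.cast_nonneg _) (one_le_pow₀ one_le_two)
      have h4 : x ^ 2 * ((2 : ℝ) ^ (-((j : ℝ) * (t + 1 / 2)))) ^ 4 * (2 : ℝ) ^ (j : ℝ) = 1 := by
        rw [hx, ← Real.rpow_natCast, ← Real.rpow_natCast, ← Real.rpow_mul zero_le_two,
          ← Real.rpow_mul zero_le_two, ← Real.rpow_add two_pos, ← Real.rpow_add two_pos]
        rw [← Real.rpow_zero 2]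
        congr 1
        push_cast
        rw [hθ]
        ring
      calc (Real.sqrt n * a) ^ 4 * N = (n : ℝ) ^ 2 * a ^ 4 * N := by rw [mul_pow, h2]
        _ ≤ x ^ 2 * a ^ 4 * (2 : ℝ) ^ (j : ℝ) := by gcongr
        _ = ε ^ 4 * (x ^ 2 * ((2 : ℝ) ^ (-((j : ℝ) * (t + 1 / 2)))) ^ 4 * (2 : ℝ) ^ (j : ℝ)) := by
          rw [ha, mul_pow]; ring
        _ = ε ^ 4 := by rw [h4, mul_one]
    have hε1 : ε ≤ 1 := hεδ.trans hδ1
    have h5 : ε ^ 4 ≤ δ ^ 2 :=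
      (pow_le_pow_of_le_one (m := 2) hε0.le hε1 (by norm_num)).trans (by gcongr)
    have h6 := exp_half_le (ε := ε ^ 4) (by positivity) (pow_le_one₀ hε0.le hε1)
    have h7 : Real.exp ((Real.sqrt n * a) ^ 4 * N / 2) ≤ Real.exp (ε ^ 4 / 2) := by gcongr
    linarith
  have h0 : (0 : LpUnit p) ∈ model W p t s B (υ * (n : ℝ) ^ (-(t / θ))) :=
    ⟨Or.inr (W.zero_mem_besovBall hp1 s B),
      (memLp_congr_ae (Lp.coeFn_zero ℝ (ENNReal.ofReal p) unitVolume)).2 MemLp.zero⟩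
  obtain ⟨hsmall, hcover⟩ := hCL n hn1
  obtain ⟨hdm, hd⟩ := hsmall s (by simp)
  have key := mul_le_one_of_separated hβ hBr.toIsPreBrownianReal hn1 hp1
    (u := fun i k ↦ W.psi j (W.node (i * N + k))) (fun i k ↦ W.memLp_psi hj0 (hnode i k))
    (fun i k k' ↦ ?_) hα.le hδ0 hchi hF hsep hdm
    (hd 0 ⟨W.zero_mem_besovBall hp1 s B, h0⟩)
    (fun i b ↦ (hcover _ (hFmodel i b)).1) (fun i b ↦ (hcover _ (hFmodel i b)).2)
  · have : 1 - 2 * α - δ = δ := by rw [hδ]; ring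
    rw [this] at key
    linarith
  · rw [W.pairing_psi_psi hj0 (hnode i k) hj0 (hnode i k')]
    refine if_congr ⟨fun h ↦ ?_, fun h ↦ ⟨rfl, by rw [h]⟩⟩ rfl rfl
    have := W.node_injective h.2
    exact Fin.ext (by omega)
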